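/- Let $S$ and $A$ be finite sets and consider a Markov decision process with states $S$ and actions $A$: taking action $a$ in state $s$ produces a next state and a reward with joint law $\kappa(\cdot\mid s,a)$ on $S\times\mathbb{R}$, where rewards satisfy $|r|\le R_{\max}$ almost surely. Write $P(s'\mid s,a)$ for the transition probabilities and $R(s,a)$ for the mean rewards. Let $\gamma\in(0,1)$, and let $$Q^*(s,a)=\max_{\pi:S\to A}\ \sum_{k\ge 0}\gamma^k\,\mathbb{E}\left[r_k\mid s_0=s,\ a_0=a,\ a_i=\pi(s_i)\text{ for } i\ge 1\right]$$ be the optimal Q-function. Let $K\ge 1$ and $M\ge 0$ be integers. Q-learning with uniform experience replay starts from a table $Q_0:S\times A\to\mathbb{R}$ and an empty memory buffer. Its iterations $t=0,1,2,\dots$ come in periods of $K$ online iterations followed by $M$ replay iterations. * In an online iteration the learner is in the current state $s$, chooses an action $a$ in any way from the past and independent randomization (for example greedily, or to explore), and receives a reward $r$ and moves to a state $s'$, where $(s',r)$ has conditional law $\kappa(\cdot\mid s,a)$ given the past and the choice of $a$. The transition $(s,a,r,s')$ is stored in the buffer, and $s'$ becomes the current state. * In a replay iteration a transition $(s,a,r,s')$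 is drawn uniformly at random, given the past, from all transitions stored in the buffer. The current state does not change. In either case the table is updated by $$Q_{t+1}(s,a)=(1-\alpha_t(s,a))\,Q_t(s,a)+\alpha_t(s,a)\Big(r+\gamma\max_{a'\in A}Q_t(s',a')\Big),$$ and all its other entries are unchanged. The learning rate used to update a pair may be random, but for each pair it is determined by the information available before the transition of iteration $t$ is drawn (that is, by the past and, in an online iteration, the chosen action). We set $\alpha_t(s,a)=0$ for the pairs that are not updated in iteration $t$. Assume that almost surely, for all $s\in S$ and $a\in A$, the pair $(s,a)$ is visited in infinitely many online iterations, and $$\alpha_t(s,a)\ge 0\ \text{ for all } t,\qquad \sum_{t=0}^\infty\alpha_t(s,a)=\infty,\qquad \sum_{t=0}^\infty\alpha_t(s,a)^2<\infty .$$ Then almost surely $\lim_{t\to\infty}Q_t(s,a)=Q^*(s,a)$ for all $s\in S$ and $a\in A$. -/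

import Mathlib

open MeasureTheory ProbabilityTheory Filter Topology

noncomputable section

/-- A Markov decision process with states `S` and actions `A`. `law s a` is the joint law of
(next state, reward) when action `a` is taken in state `s`; rewards are bounded by `Rmax`.
Transition probabilities and mean rewards are its marginals, `MDP.P` and `MDP.R`. -/
structure MDP (S A : Type*) [MeasurableSpace S] where
  law : S → A → Measure (S × ℝ)
  isProbabilityMeasure_law : ∀ s a, IsProbabilityMeasure (law s a)
  Rmax : ℝ
  abs_reward_le : ∀ s a, ∀ᵐ x ∂(law s a), |x.2| ≤ Rmax

namespace MDP

variable {S A : Type*} [MeasurableSpace S]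

/-- Transition probability `P(s' | s, a)`. -/
def P (𝓜 : MDP S A) (s : S) (a : A) (s' : S) : ℝ :=
  (𝓜.law s a).real (Prod.fst ⁻¹' {s'})

/-- Mean reward `R(s, a)`. -/
def R (𝓜 : MDP S A) (s : S) (a : A) : ℝ :=
  ∫ x, x.2 ∂(𝓜.law s a)

/-- `𝔼[r_k | s₀ = s, a₀ = a, π]`: the expected reward received at step `k` when action `a` is taken
in state `s` at step `0`, and the policy `π` is followed from then on. -/
def expReward [Fintype S] (𝓜 : MDP S A) (π : S → A) : ℕ → S → A → ℝ
  | 0 => fun s a => 𝓜.R s a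
  | k + 1 => fun s a => ∑ s', 𝓜.P s a s' * expReward 𝓜 π k s' (π s')

/-- `Q^π(s, a) = ∑ₖ γᵏ 𝔼[r_k | s₀ = s, a₀ = a, π]`, the expected discounted reward. -/
def policyQ [Fintype S] (𝓜 : MDP S A) (γ : ℝ) (π : S → A) (s : S) (a : A) : ℝ :=
  ∑' k : ℕ, γ ^ k * 𝓜.expReward π k s a

/-- The optimal Q-function `Q*(s, a) = max_π Q^π(s, a)`, over the policies `π : S → A`
(a maximum, since `S` and `A` are finite). -/
def optimalQ [Fintype S] (𝓜 : MDP S A) (γ : ℝ) (s : S) (a : A) : ℝ :=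
  ⨆ π : S → A, 𝓜.policyQ γ π s a

end MDP

/-- Iterations (updates of the table) are numbered `t = 0, 1, 2, …`. They come in periods of `K`
online iterations followed by `M` replay iterations. -/
abbrev IsOnline (K M t : ℕ) : Prop := t % (K + M) < K

/-- The number of online iterations before iteration `t`, which is the number of transitions in
the memory buffer just before iteration `t`. -/
def onlineCount (K M t : ℕ) : ℕ := Nat.count (IsOnline K M) t

/-- The random variables that occur in Q-learning with experience replay. In the `i`-th online
interaction (`i = 0, 1, …`) the learner sees `state i`, takes `action i`, receives `reward i` and
moves to `state (i + 1)`; this transition is the `i`-th entry of the memory buffer.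
`index t` is the buffer position drawn in iteration `t` (it is used for replay iterations only), and
`rate t ω s a` is the learning rate that iteration `t` uses if it updates the pair `(s, a)`. -/
structure ReplayProcess (Ω S A : Type*) where
  state : ℕ → Ω → S
  action : ℕ → Ω → A
  reward : ℕ → Ω → ℝ
  index : ℕ → Ω → ℕ
  rate : ℕ → Ω → S → A → ℝ

namespace ReplayProcess

variable {Ω S A : Type*}

/-- The number of the transition `(s, a, r, s')` with which iteration `t` updates the table: the
current one if `t` is online, the one drawn from the buffer if `t` is a replay iteration. -/
def entry (D : ReplayProcess Ω S A) (K M t : ℕ) (ω : Ω) : ℕ :=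
  if IsOnline K M t then onlineCount K M t else D.index t ω

/-- The learning rate `α_t(s, a)`, which is `0` for the pairs not updated in iteration `t`. -/
def alpha [DecidableEq S] [DecidableEq A] (D : ReplayProcess Ω S A) (K M t : ℕ) (ω : Ω)
    (s : S) (a : A) : ℝ :=
  if D.state (D.entry K M t ω) ω = s ∧ D.action (D.entry K M t ω) ω = a then D.rate t ω s a else 0

/-- The table after `t` iterations, started from `Q₀`. -/
def Q [DecidableEq S] [DecidableEq A] (D : ReplayProcess Ω S A) (K M : ℕ) (γ : ℝ)
    (Q₀ : S → A → ℝ) : ℕ → Ω → S → A → ℝ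
  | 0 => fun _ => Q₀
  | t + 1 => fun ω s a =>
      (1 - D.alpha K M t ω s a) * Q D K M γ Q₀ t ω s a
        + D.alpha K M t ω s a *
          (D.reward (D.entry K M t ω) ω
            + γ * ⨆ a', Q D K M γ Q₀ t ω (D.state (D.entry K M t ω + 1) ω) a')

/-- `D` is a run of Q-learning with uniform experience replay in the MDP `𝓜`. `ℱ t` is the
information available in iteration `t` just before its transition is drawn: all that happened in
earlier iterations and, if `t` is online, the action that the learner has chosen (in any way, from
the past and from further randomization). -/
structure IsRun [MeasurableSpace S] [MeasurableSpace A] {mΩ : MeasurableSpace Ω}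
    (D : ReplayProcess Ω S A) (𝓜 : MDP S A) (K M : ℕ) (μ : Measure Ω)
    (ℱ : Filtration ℕ mΩ) : Prop where
  measurable_state : ∀ t, Measurable[ℱ t] (D.state (onlineCount K M t))
  measurable_action : ∀ t, IsOnline K M t → Measurable[ℱ t] (D.action (onlineCount K M t))
  measurable_reward : ∀ t, IsOnline K M t → Measurable[ℱ (t + 1)] (D.reward (onlineCount K M t))
  measurable_index : ∀ t, ¬ IsOnline K M t → Measurable[ℱ (t + 1)] (D.index t)
  measurable_rate : ∀ t s a, Measurable[ℱ t] (fun ω => D.rate t ω s a)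
  /-- In an online iteration the next state and the reward are drawn from the MDP. -/
  online_law : ∀ t, IsOnline K M t → ∀ B : Set (S × ℝ), MeasurableSet B →
    μ⟦(fun ω => (D.state (onlineCount K M t + 1) ω, D.reward (onlineCount K M t) ω)) ⁻¹' B | ℱ t⟧
      =ᵐ[μ] fun ω => (𝓜.law (D.state (onlineCount K M t) ω)
        (D.action (onlineCount K M t) ω)).real B
  /-- In a replay iteration the position is drawn uniformly from the buffer. -/
  replay_law : ∀ t, ¬ IsOnline K M t → ∀ j < onlineCount K M t,
    μ⟦D.index t ⁻¹' {j} | ℱ t⟧ =ᵐ[μ] fun _ => 1 / (onlineCount K M t : ℝ)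

end ReplayProcess

end

/-! Fix a pair `(s, a)`. Its update is a relaxation step of size `α_t` towards a random target,
which splits into a conditional mean and a deviation from it (`innovation`). In an online iteration
the conditional mean given an update of the pair is the Bellman operator applied to the current
table. In a replay iteration it is the same expression with the MDP's law replaced by the empirical
law of the buffered transitions from `(s, a)`.

Replay therefore introduces a bias but no further difficulty. The buffer is known before the draw,
so the innovations still have conditional mean zero (`condExp_innovation`). The empirical law
converges to the true one by a strong law of large numbers (`tendsto_condMean`), since every pair is
visited infinitely often. The table stays bounded, so the bias tends to `0`
(`tendsto_meanTarget_sub_bellman`) although the table is not yet known to converge.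

The noise is a martingale difference sequence, bounded after a cutoff and dominated by a multiple of
`α_t`. Square summability of the rates makes its sum converge
(`ae_exists_tendsto_sum_of_summable_sq`), and noise with convergent sum does not affect where a
relaxation with divergent step sum ends up (`eventually_abs_le_add_of_noisy_relaxation`). These two
facts also give the strong law, as an empirical mean is a relaxation with steps `1, 1/2, 1/3, …`.

The rest is contraction: if the distance from the table to `Q*` is asymptotically at most `d`, the
target is asymptotically within `γ d` of `Q*`, hence so is the table. Iterating gives `γ ^ n * d₀`
for every `n`. -/

/-! ### Deterministic relaxation with step sizes of divergent sum -/

/-- A sequence that relaxes towards `[-c, c]` with non-summable step sizes eventually gets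
arbitrarily close to it. -/
theorem eventually_abs_le_add_of_relaxation {a x : ℕ → ℝ} {c : ℝ}
    (ha1 : ∀ᶠ n in atTop, a n ≤ 1)
    (hsum : Tendsto (fun n => ∑ k ∈ Finset.range n, a k) atTop atTop)
    (hrec : ∀ᶠ n in atTop, |x (n + 1)| ≤ (1 - a n) * |x n| + a n * c)
    {ε : ℝ} (hε : 0 < ε) : ∀ᶠ n in atTop, |x n| ≤ c + ε := by
  obtain ⟨N, hN⟩ := eventually_atTop.1 (ha1.and hrec)
  set σ : ℕ → ℝ := fun n => ∑ k ∈ Finset.range n, a k with hσ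
  -- Clipping at `0` makes the bound nonnegative, so that the factor `1 - a n` can be replaced by
  -- the larger `exp (-a n)`.
  set m := max (|x N| - c) 0 with hm
  have hm0 : 0 ≤ m := le_max_right _ _
  have key : ∀ n, N ≤ n → |x n| - c ≤ m * Real.exp (-(σ n - σ N)) := by
    intro n hn
    induction n, hn using Nat.le_induction with
    | base => simp [hm]
    | succ n hn ih =>
      obtain ⟨h1, h2⟩ := hN n hn
      have h3 : |x (n + 1)| - c ≤ (1 - a n) * (|x n| - c) := by linarith
      have h4 : σ (n + 1) = σ n + a n := Finset.sum_range_succ _ _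
      have h5 : Real.exp (-(σ (n + 1) - σ N)) =
          Real.exp (-a n) * Real.exp (-(σ n - σ N)) := by
        rw [← Real.exp_add, h4]; congr 1; ring
      have h6 : 1 - a n ≤ Real.exp (-a n) := by
        have := Real.add_one_le_exp (-a n); linarith
      have h7 : 0 ≤ m * Real.exp (-(σ n - σ N)) := by positivity
      calc |x (n + 1)| - c ≤ (1 - a n) * (|x n| - c) := h3
        _ ≤ (1 - a n) * (m * Real.exp (-(σ n - σ N))) :=
          mul_le_mul_of_nonneg_left ih (by linarith)
        _ ≤ Real.exp (-a n) * (m * Real.exp (-(σ n - σ N))) :=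
          mul_le_mul_of_nonneg_right h6 h7
        _ = _ := by rw [h5]; ring
  have hlim : Tendsto (fun n => m * Real.exp (-(σ n - σ N))) atTop (𝓝 0) := by
    have : Tendsto (fun n => Real.exp (-(σ n - σ N))) atTop (𝓝 0) :=
      Real.tendsto_exp_neg_atTop_nhds_zero.comp (tendsto_atTop_add_const_right _ _ hsum)
    simpa using this.const_mul m
  filter_upwards [hlim.eventually_lt_const hε, eventually_ge_atTop N] with n h1 h2
  have := key n h2
  linarith

/-- Stochastic approximation in one coordinate: increments `d` with a convergent sum do not
influence the asymptotic bound. -/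
theorem eventually_abs_le_add_of_noisy_relaxation {a x F d : ℕ → ℝ} {c : ℝ}
    (ha0 : ∀ n, 0 ≤ a n) (ha1 : ∀ᶠ n in atTop, a n ≤ 1)
    (hsum : Tendsto (fun n => ∑ k ∈ Finset.range n, a k) atTop atTop)
    (hd : ∃ L, Tendsto (fun n => ∑ k ∈ Finset.range n, d k) atTop (𝓝 L))
    (hF : ∀ᶠ n in atTop, |F n| ≤ c)
    (hrec : ∀ᶠ n in atTop, x (n + 1) = (1 - a n) * x n + a n * F n + d n)
    {ε : ℝ} (hε : 0 < ε) : ∀ᶠ n in atTop, |x n| ≤ c + ε := by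
  obtain ⟨L, hL⟩ := hd
  -- `T` is minus the tail of the noise series and tends to `0`. Subtracting it absorbs the noise:
  -- `x - T` relaxes, without `d`, towards `F - T`.
  set T : ℕ → ℝ := fun n => ∑ k ∈ Finset.range n, d k - L with hT
  have hT0 : ∀ᶠ n in atTop, |T n| ≤ ε / 3 := by
    have h1 : Tendsto T atTop (𝓝 0) := by simpa [hT] using hL.sub_const L
    have h2 := h1.abs
    rw [abs_zero] at h2
    filter_upwards [h2.eventually_lt_const (show 0 < ε / 3 by linarith)] with n hn using hn.le
  have hy := eventually_abs_le_add_of_relaxation (x := fun n => x n - T n) (c := c + ε / 3)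
    ha1 hsum ?_ (show 0 < ε / 3 by linarith)
  · filter_upwards [hT0, hy] with n h1 h2
    have h3 := abs_add_le (x n - T n) (T n)
    rw [sub_add_cancel] at h3
    linarith
  · filter_upwards [hrec, hF, hT0, ha1] with n h1 h2 h3 h4
    have h5 : T (n + 1) = T n + d n := by
      simp only [hT, Finset.sum_range_succ]; ring
    have h6 : x (n + 1) - T (n + 1) = (1 - a n) * (x n - T n) + a n * (F n - T n) := by
      rw [h1, h5]; ring
    rw [h6]
    refine (abs_add_le _ _).trans ?_
    rw [abs_mul, abs_mul, abs_of_nonneg (ha0 n), abs_of_nonneg (show 0 ≤ 1 - a n by linarith)]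
    have h7 := abs_sub (F n) (T n)
    gcongr
    · exact ha0 n
    · linarith

/-! ### Martingale convergence -/

/-- A martingale with bounded increments converges almost surely where its increments are
square summable. -/
theorem ae_exists_tendsto_sum_of_summable_sq {Ω : Type*} {mΩ : MeasurableSpace Ω}
    {μ : Measure Ω} [IsProbabilityMeasure μ] {ℱ : Filtration ℕ mΩ} {ξ : ℕ → Ω → ℝ} {C : ℝ}
    (hmeas : ∀ t, Measurable[ℱ (t + 1)] (ξ t)) (hbdd : ∀ t ω, |ξ t ω| ≤ C)
    (hcond : ∀ t, μ[ξ t | ℱ t] =ᵐ[μ] 0) :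
    ∀ᵐ ω ∂μ, Summable (fun t => ξ t ω ^ 2) →
      ∃ L, Tendsto (fun n => ∑ t ∈ Finset.range n, ξ t ω) atTop (𝓝 L) := by
  have hsqb : ∀ t ω, ξ t ω ^ 2 ≤ C ^ 2 := fun t ω =>
    sq_le_sq.2 ((hbdd t ω).trans (le_abs_self C))
  have hmξ : ∀ {t n}, t < n → Measurable[ℱ n] (ξ t) := fun {t n} h =>
    (hmeas t).mono (ℱ.mono h) le_rfl
  have htrunc : ∀ B : ℕ, ∀ᵐ ω ∂μ, (∀ n, ∑ t ∈ Finset.range n, ξ t ω ^ 2 ≤ B) →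
      ∃ L, Tendsto (fun n => ∑ t ∈ Finset.range n, ξ t ω) atTop (𝓝 L) := by
    intro B
    -- Increments are kept only while the sum of the earlier squares is at most `B`. This event
    -- belongs to `ℱ t`, so the stopped increments still have conditional mean zero.
    set G : ℕ → Set Ω := fun t => {ω | ∑ k ∈ Finset.range t, ξ k ω ^ 2 ≤ B} with hG
    have hGm : ∀ t, MeasurableSet[ℱ t] (G t) := by
      intro t
      have h1 : Measurable[ℱ t] (fun ω => ∑ k ∈ Finset.range t, ξ k ω ^ 2) :=
        Finset.measurable_sum _ fun k hk => (hmξ (Finset.mem_range.1 hk)).pow_const 2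
      exact h1 measurableSet_Iic
    set η : ℕ → Ω → ℝ := fun t => (G t).indicator (ξ t) with hη
    set X : ℕ → Ω → ℝ := fun n ω => ∑ t ∈ Finset.range n, η t ω with hX
    have hηm : ∀ t, Measurable[ℱ (t + 1)] (η t) := fun t =>
      (hmeas t).indicator (ℱ.mono t.le_succ _ (hGm t))
    have hηC : ∀ t ω, |η t ω| ≤ C := by
      intro t ω
      by_cases h : ω ∈ G t
      · simpa [hη, h] using hbdd t ω
      · simpa [hη, h] using (abs_nonneg _).trans (hbdd t ω)
    have hXm : ∀ n, Measurable[ℱ n] (X n) := fun n =>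
      Finset.measurable_sum _ fun k hk =>
        (hηm k).mono (ℱ.mono (Finset.mem_range.1 hk)) le_rfl
    have hξi : ∀ t, Integrable (ξ t) μ := fun t =>
      Integrable.of_bound ((hmeas t).mono (ℱ.le _) le_rfl).aestronglyMeasurable C
        (ae_of_all _ fun ω => hbdd t ω)
    have hηi : ∀ t, Integrable (η t) μ := fun t =>
      Integrable.of_bound ((hηm t).mono (ℱ.le _) le_rfl).aestronglyMeasurable C
        (ae_of_all _ fun ω => hηC t ω)
    have hXb : ∀ n ω, |X n ω| ≤ n * C := by
      intro n ω
      refine (Finset.abs_sum_le_sum_abs _ _).trans ?_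
      refine (Finset.sum_le_sum fun k _ => hηC k ω).trans ?_
      simp
    have hXi : ∀ n, Integrable (X n) μ := fun n =>
      Integrable.of_bound ((hXm n).mono (ℱ.le _) le_rfl).aestronglyMeasurable (n * C)
        (ae_of_all _ fun ω => hXb n ω)
    have hηc : ∀ t, μ[η t | ℱ t] =ᵐ[μ] 0 := by
      intro t
      refine (condExp_indicator (hξi t) (hGm t)).trans ?_
      filter_upwards [hcond t] with ω hω
      by_cases h : ω ∈ G t <;> simp [h, hω]
    have hXη : ∀ n, X (n + 1) - X n = η n := by
      intro n; ext ω; simp [hX, Finset.sum_range_succ]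
    have hmart : Martingale X ℱ μ := by
      refine martingale_of_condExp_sub_eq_zero_nat (fun n => (hXm n).stronglyMeasurable) hXi ?_
      intro n
      rw [hXη]
      exact hηc n
    -- Orthogonality of martingale increments: it reduces the second moment of `X n` to the sum of
    -- those of its increments.
    have hcross : ∀ n, ∫ ω, X n ω * η n ω ∂μ = 0 := by
      intro n
      have hi : Integrable (X n * η n) μ :=
        (hηi n).bdd_mul ((hXm n).mono (ℱ.le _) le_rfl).aestronglyMeasurable
          (ae_of_all _ fun ω => hXb n ω)
      have h1 := condExp_mul_of_stronglyMeasurable_left (hXm n).stronglyMeasurable hi (hηi n)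
      have h2 : μ[X n * η n | ℱ n] =ᵐ[μ] 0 := by
        filter_upwards [h1, hηc n] with ω h3 h4
        rw [h3]; simp [h4]
      calc ∫ ω, X n ω * η n ω ∂μ = ∫ ω, (μ[X n * η n | ℱ n]) ω ∂μ :=
            (integral_condExp (ℱ.le n)).symm
        _ = 0 := by rw [integral_congr_ae h2]; simp
    have hη2i : ∀ t, Integrable (fun ω => η t ω ^ 2) μ := fun t =>
      Integrable.of_bound (((hηm t).mono (ℱ.le _) le_rfl).pow_const 2).aestronglyMeasurable
        (C ^ 2) (ae_of_all _ fun ω => by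
          rw [Real.norm_of_nonneg (sq_nonneg _)]
          exact sq_le_sq.2 ((hηC t ω).trans (le_abs_self C)))
    have hX2i : ∀ n, Integrable (fun ω => X n ω ^ 2) μ := fun n =>
      Integrable.of_bound (((hXm n).mono (ℱ.le _) le_rfl).pow_const 2).aestronglyMeasurable
        ((n * C) ^ 2) (ae_of_all _ fun ω => by
          rw [Real.norm_of_nonneg (sq_nonneg _)]
          exact sq_le_sq.2 ((hXb n ω).trans (le_abs_self _)))
    have hXηi : ∀ n, Integrable (fun ω => 2 * (X n ω * η n ω)) μ := fun n =>
      ((hηi n).bdd_mul ((hXm n).mono (ℱ.le _) le_rfl).aestronglyMeasurable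
          (ae_of_all _ fun ω => hXb n ω)).const_mul 2
    have hL2 : ∀ n, ∫ ω, X n ω ^ 2 ∂μ = ∫ ω, ∑ t ∈ Finset.range n, η t ω ^ 2 ∂μ := by
      intro n
      rw [integral_finsetSum _ fun t _ => hη2i t]
      induction n with
      | zero => simp [hX]
      | succ n ih =>
        rw [Finset.sum_range_succ, ← ih]
        have h1 : (fun ω => X (n + 1) ω ^ 2) =
            fun ω => (X n ω ^ 2 + 2 * (X n ω * η n ω)) + η n ω ^ 2 := by
          ext ω; simp only [hX, Finset.sum_range_succ]; ring
        have h2 : Integrable (fun ω => X n ω ^ 2 + 2 * (X n ω * η n ω)) μ :=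
          (hX2i n).add (hXηi n)
        rw [h1, integral_add h2 (hη2i n), integral_add (hX2i n) (hXηi n),
          integral_const_mul, hcross]
        simp
    -- The stopped sum can exceed `B` by at most one increment, hence the extra `C ^ 2`.
    have hpath : ∀ n ω, ∑ t ∈ Finset.range n, η t ω ^ 2 ≤ B + C ^ 2 := by
      intro n ω
      induction n with
      | zero => simp; positivity
      | succ n ih =>
        rw [Finset.sum_range_succ]
        by_cases h : ω ∈ G n
        · have h1 : ∑ t ∈ Finset.range n, η t ω ^ 2 ≤ ∑ t ∈ Finset.range n, ξ t ω ^ 2 := by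
            refine Finset.sum_le_sum fun t _ => ?_
            by_cases h' : ω ∈ G t
            · simp [hη, h']
            · simp [hη, h', sq_nonneg]
          have h2 : η n ω = ξ n ω := by simp [hη, h]
          rw [h2]
          exact add_le_add (h1.trans h) (hsqb n ω)
        · have h2 : η n ω = 0 := by simp [hη, h]
          rw [h2]; simpa using ih
    -- The uniform `L²` bound becomes the `L¹` bound of the convergence theorem through `|x| ≤ x ^ 2
    -- + 1`.
    have hL1 : ∀ n, eLpNorm (X n) 1 μ ≤ ((B + C ^ 2 + 1).toNNReal : NNReal) := by
      intro n
      rw [eLpNorm_one_eq_lintegral_enorm, ← ofReal_integral_norm_eq_lintegral_enorm (hXi n)]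
      refine ENNReal.ofReal_le_ofReal ?_
      calc ∫ ω, ‖X n ω‖ ∂μ ≤ ∫ ω, (X n ω ^ 2 + 1) ∂μ := by
            refine integral_mono (hXi n).norm ((hX2i n).add (integrable_const 1)) fun ω => ?_
            simp only [Real.norm_eq_abs]
            nlinarith [sq_abs (X n ω), sq_nonneg (|X n ω| - 1), sq_nonneg (X n ω)]
        _ = ∫ ω, X n ω ^ 2 ∂μ + 1 := by
            rw [integral_add (hX2i n) (integrable_const 1)]; simp
        _ ≤ (B + C ^ 2) + 1 := by
            gcongr
            rw [hL2]
            refine (integral_mono (integrable_finsetSum _ fun t _ => hη2i t)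
              (integrable_const (B + C ^ 2)) (fun ω => hpath n ω)).trans ?_
            simp
    filter_upwards [hmart.submartingale.exists_ae_tendsto_of_bdd hL1] with ω hω hB
    obtain ⟨L, hL⟩ := hω
    refine ⟨L, hL.congr fun n => Finset.sum_congr rfl fun t _ => ?_⟩
    simp [hη, hG, hB t]
  filter_upwards [ae_all_iff.2 htrunc] with ω hω hs
  obtain ⟨B, hB⟩ := exists_nat_ge (∑' t, ξ t ω ^ 2)
  exact hω B fun n => (hs.sum_le_tsum _ fun t _ => sq_nonneg _).trans hB

/-! ### Bellman equations and the optimal Q-function -/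

/-- The supremum over a finite type is nonexpansive. -/
theorem abs_ciSup_sub_ciSup_le {ι : Type*} [Finite ι] {f g : ι → ℝ} {c : ℝ} (hc : 0 ≤ c)
    (h : ∀ i, |f i - g i| ≤ c) : |(⨆ i, f i) - ⨆ i, g i| ≤ c := by
  cases isEmpty_or_nonempty ι
  · simpa using hc
  rw [abs_le]
  constructor
  · have : (⨆ i, g i) ≤ (⨆ i, f i) + c := ciSup_le fun i => by
      have h1 := (abs_le.1 (h i)).1
      have h2 := le_ciSup (Set.finite_range f).bddAbove i
      linarith
    linarith
  · have : (⨆ i, f i) ≤ (⨆ i, g i) + c := ciSup_le fun i => by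
      have h1 := (abs_le.1 (h i)).2
      have h2 := le_ciSup (Set.finite_range g).bddAbove i
      linarith
    linarith

theorem abs_ciSup_le {ι : Type*} [Finite ι] {f : ι → ℝ} {c : ℝ} (hc : 0 ≤ c)
    (h : ∀ i, |f i| ≤ c) : |⨆ i, f i| ≤ c := by
  have h1 := abs_ciSup_sub_ciSup_le (f := f) (g := fun _ => 0) hc (by simpa using h)
  simpa using h1

namespace MDP

variable {S A : Type*} [MeasurableSpace S]

theorem P_nonneg (𝓜 : MDP S A) (s : S) (a : A) (s' : S) : 0 ≤ 𝓜.P s a s' := measureReal_nonneg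

theorem sum_P [Fintype S] [MeasurableSingletonClass S] (𝓜 : MDP S A) (s : S) (a : A) :
    ∑ s', 𝓜.P s a s' = 1 := by
  have := 𝓜.isProbabilityMeasure_law s a
  have h1 : ∀ s', 𝓜.P s a s' = ((𝓜.law s a).map Prod.fst).real {s'} := fun s' =>
    (map_measureReal_apply measurable_fst (measurableSet_singleton s')).symm
  have : IsProbabilityMeasure ((𝓜.law s a).map Prod.fst) :=
    Measure.isProbabilityMeasure_map measurable_fst.aemeasurable
  simp only [h1, sum_measureReal_singleton, Finset.coe_univ, probReal_univ]

/-- The expectation of the value of the next state. -/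
theorem abs_sum_P_mul_le [Fintype S] [MeasurableSingletonClass S] (𝓜 : MDP S A) (s : S) (a : A)
    {v : S → ℝ} {c : ℝ} (h : ∀ x, |v x| ≤ c) : |∑ x, 𝓜.P s a x * v x| ≤ c := by
  calc |∑ x, 𝓜.P s a x * v x| ≤ ∑ x, |𝓜.P s a x * v x| := Finset.abs_sum_le_sum_abs _ _
    _ ≤ ∑ x, 𝓜.P s a x * c := Finset.sum_le_sum fun x _ => by
        rw [abs_mul, abs_of_nonneg (𝓜.P_nonneg s a x)]
        exact mul_le_mul_of_nonneg_left (h x) (𝓜.P_nonneg s a x)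
    _ = c := by rw [← Finset.sum_mul, sum_P, one_mul]

theorem abs_R_le (𝓜 : MDP S A) (s : S) (a : A) : |𝓜.R s a| ≤ 𝓜.Rmax := by
  have := 𝓜.isProbabilityMeasure_law s a
  have := norm_integral_le_of_norm_le_const (μ := 𝓜.law s a)
    (f := fun x => x.2) (𝓜.abs_reward_le s a)
  simpa [R] using this

theorem abs_integral_law_le (𝓜 : MDP S A) (s : S) (a : A) {f : S × ℝ → ℝ} {C : ℝ}
    (hf : ∀ x, |f x| ≤ C) : |∫ x, f x ∂(𝓜.law s a)| ≤ C := by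
  have := 𝓜.isProbabilityMeasure_law s a
  simpa using norm_integral_le_of_norm_le_const (μ := 𝓜.law s a) (f := f) (ae_of_all _ hf)

/-- The Bellman optimality operator. -/
noncomputable def bellman [Fintype S] (𝓜 : MDP S A) (γ : ℝ) (q : S → A → ℝ) (s : S) (a : A) : ℝ :=
  𝓜.R s a + γ * ∑ x, 𝓜.P s a x * ⨆ b, q x b

variable [Fintype S] [MeasurableSingletonClass S]

theorem abs_expReward_le (𝓜 : MDP S A) (π : S → A) (k : ℕ) (s : S) (a : A) :
    |𝓜.expReward π k s a| ≤ 𝓜.Rmax := by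
  induction k generalizing s a with
  | zero => exact 𝓜.abs_R_le s a
  | succ k ih => exact 𝓜.abs_sum_P_mul_le s a fun x => ih x (π x)

theorem summable_expReward (𝓜 : MDP S A) {γ : ℝ} (hγ0 : 0 ≤ γ) (hγ1 : γ < 1) (π : S → A)
    (s : S) (a : A) : Summable fun k => γ ^ k * 𝓜.expReward π k s a := by
  refine Summable.of_norm_bounded
    ((summable_geometric_of_lt_one hγ0 hγ1).mul_right 𝓜.Rmax) fun k => ?_
  rw [norm_mul, norm_pow, Real.norm_of_nonneg hγ0]
  exact mul_le_mul_of_nonneg_left (𝓜.abs_expReward_le π k s a) (by positivity)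

/-- The Bellman equation of a policy. -/
theorem policyQ_eq (𝓜 : MDP S A) {γ : ℝ} (hγ0 : 0 ≤ γ) (hγ1 : γ < 1) (π : S → A) (s : S) (a : A) :
    𝓜.policyQ γ π s a = 𝓜.R s a + γ * ∑ x, 𝓜.P s a x * 𝓜.policyQ γ π x (π x) := by
  have hs := 𝓜.summable_expReward hγ0 hγ1 π
  rw [policyQ, (hs s a).tsum_eq_zero_add]
  congr 1
  · simp [expReward]
  · simp only [policyQ, ← tsum_mul_left]
    rw [← Summable.tsum_finsetSum fun x _ => (hs x (π x)).mul_left _, ← tsum_mul_left]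
    congr 1; ext k
    simp only [expReward, Finset.mul_sum]
    exact Finset.sum_congr rfl fun x _ => by ring

/-- Maximum principle: an average of `d` is at most its maximum, so the maximum is at most `γ` times
itself and cannot be positive. -/
theorem nonpos_of_le_mul_sum_P (𝓜 : MDP S A) {γ : ℝ} (hγ0 : 0 ≤ γ)
    (hγ1 : γ < 1) (π : S → A) {d : S → ℝ}
    (h : ∀ s, d s ≤ γ * ∑ x, 𝓜.P s (π s) x * d x) (s : S) : d s ≤ 0 := by
  have : Nonempty S := ⟨s⟩
  obtain ⟨s₀, hs₀⟩ := Finite.exists_max d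
  have h1 : ∑ x, 𝓜.P s₀ (π s₀) x * d x ≤ d s₀ := by
    calc ∑ x, 𝓜.P s₀ (π s₀) x * d x ≤ ∑ x, 𝓜.P s₀ (π s₀) x * d s₀ :=
          Finset.sum_le_sum fun x _ => mul_le_mul_of_nonneg_left (hs₀ x) (𝓜.P_nonneg _ _ _)
      _ = d s₀ := by rw [← Finset.sum_mul, sum_P, one_mul]
  have h2 := (h s₀).trans (mul_le_mul_of_nonneg_left h1 hγ0)
  have h3 : d s₀ ≤ 0 := by nlinarith
  exact (hs₀ s).trans h3

variable [Fintype A]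

theorem abs_bellman_sub_le (𝓜 : MDP S A) {γ : ℝ} (hγ : 0 ≤ γ) {q q' : S → A → ℝ} {c : ℝ}
    (hc : 0 ≤ c) (h : ∀ s a, |q s a - q' s a| ≤ c) (s : S) (a : A) :
    |𝓜.bellman γ q s a - 𝓜.bellman γ q' s a| ≤ γ * c := by
  have h1 : 𝓜.bellman γ q s a - 𝓜.bellman γ q' s a =
      γ * ∑ x, 𝓜.P s a x * ((⨆ b, q x b) - ⨆ b, q' x b) := by
    simp only [bellman, mul_sub, Finset.sum_sub_distrib]; ring
  rw [h1, abs_mul, abs_of_nonneg hγ]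
  exact mul_le_mul_of_nonneg_left
    (𝓜.abs_sum_P_mul_le s a fun x => abs_ciSup_sub_ciSup_le hc (h x)) hγ

theorem exists_bellman_eq (𝓜 : MDP S A) {γ : ℝ} (hγ0 : 0 ≤ γ) (hγ1 : γ < 1) :
    ∃ q, 𝓜.bellman γ q = q := by
  have h : ContractingWith ⟨γ, hγ0⟩ (𝓜.bellman γ) := by
    refine ⟨by exact_mod_cast hγ1, LipschitzWith.of_dist_le_mul fun q q' => ?_⟩
    have h1 : ∀ s a, |q s a - q' s a| ≤ dist q q' := fun s a =>
      (dist_le_pi_dist (q s) (q' s) a).trans (dist_le_pi_dist q q' s)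
    have h2 : (0 : ℝ) ≤ γ * dist q q' := by positivity
    refine (dist_pi_le_iff h2).2 fun s => (dist_pi_le_iff h2).2 fun a => ?_
    exact 𝓜.abs_bellman_sub_le hγ0 dist_nonneg h1 s a
  exact ⟨_, h.fixedPoint_isFixedPt⟩

/-- Every fixed point of the Bellman optimality operator is the optimal Q-function. -/
theorem eq_optimalQ_of_bellman_eq (𝓜 : MDP S A) {γ : ℝ} (hγ0 : 0 ≤ γ) (hγ1 : γ < 1)
    {q : S → A → ℝ} (hq : 𝓜.bellman γ q = q) (s : S) (a : A) : 𝓜.optimalQ γ s a = q s a := by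
  have : Nonempty A := ⟨a⟩
  have hq' : ∀ s a, q s a = 𝓜.R s a + γ * ∑ x, 𝓜.P s a x * ⨆ b, q x b := fun s a => by
    conv_lhs => rw [← hq]
    rfl
  have hle : ∀ x b, q x b ≤ ⨆ b, q x b := fun x b => le_ciSup (Set.finite_range _).bddAbove b
  have hupper : ∀ (π : S → A) s a, 𝓜.policyQ γ π s a ≤ q s a := by
    intro π
    have h1 : ∀ s a, 𝓜.policyQ γ π s a - q s a ≤
        γ * ∑ x, 𝓜.P s a x * (𝓜.policyQ γ π x (π x) - q x (π x)) := by
      intro s a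
      have h3 : ∑ x, 𝓜.P s a x * q x (π x) ≤ ∑ x, 𝓜.P s a x * ⨆ b, q x b :=
        Finset.sum_le_sum fun x _ => mul_le_mul_of_nonneg_left (hle x _) (𝓜.P_nonneg _ _ _)
      have h4 := mul_le_mul_of_nonneg_left h3 hγ0
      rw [𝓜.policyQ_eq hγ0 hγ1, hq' s a]
      simp only [mul_sub, Finset.sum_sub_distrib]
      linarith
    have h2 := 𝓜.nonpos_of_le_mul_sum_P hγ0 hγ1 π
      (d := fun x => 𝓜.policyQ γ π x (π x) - q x (π x)) fun s => h1 s (π s)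
    intro s a
    have h3 : ∑ x, 𝓜.P s a x * (𝓜.policyQ γ π x (π x) - q x (π x)) ≤ 0 :=
      Finset.sum_nonpos fun x _ => mul_nonpos_of_nonneg_of_nonpos (𝓜.P_nonneg _ _ _) (h2 x)
    have h4 := h1 s a
    have h5 := mul_nonpos_of_nonneg_of_nonpos hγ0 h3
    linarith
  -- For the greedy policy of `q` the suprema are attained, so the comparison with its own
  -- Q-function is an equality and can be used in the reverse direction.
  choose π hπ using fun x => exists_eq_ciSup_of_finite (f := q x)
  have hlower : q s a ≤ 𝓜.policyQ γ π s a := by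
    have h1 : ∀ s a, q s a - 𝓜.policyQ γ π s a =
        γ * ∑ x, 𝓜.P s a x * (q x (π x) - 𝓜.policyQ γ π x (π x)) := by
      intro s a
      rw [𝓜.policyQ_eq hγ0 hγ1, hq' s a]
      simp only [mul_sub, Finset.sum_sub_distrib, hπ]
      ring
    have h2 := 𝓜.nonpos_of_le_mul_sum_P hγ0 hγ1 π
      (d := fun x => q x (π x) - 𝓜.policyQ γ π x (π x)) fun s => (h1 s (π s)).le
    have h3 : ∑ x, 𝓜.P s a x * (q x (π x) - 𝓜.policyQ γ π x (π x)) ≤ 0 :=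
      Finset.sum_nonpos fun x _ => mul_nonpos_of_nonneg_of_nonpos (𝓜.P_nonneg _ _ _) (h2 x)
    have h4 := h1 s a
    have h5 := mul_nonpos_of_nonneg_of_nonpos hγ0 h3
    linarith
  refine le_antisymm (ciSup_le fun π' => hupper π' s a) (hlower.trans ?_)
  exact le_ciSup (f := fun π => 𝓜.policyQ γ π s a)
    ⟨q s a, by rintro _ ⟨π', rfl⟩; exact hupper π' s a⟩ π

theorem bellman_optimalQ (𝓜 : MDP S A) {γ : ℝ} (hγ0 : 0 ≤ γ) (hγ1 : γ < 1) :
    𝓜.bellman γ (𝓜.optimalQ γ) = 𝓜.optimalQ γ := by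
  obtain ⟨q, hq⟩ := 𝓜.exists_bellman_eq hγ0 hγ1
  have h : 𝓜.optimalQ γ = q := by
    ext s a; exact 𝓜.eq_optimalQ_of_bellman_eq hγ0 hγ1 hq s a
  rw [h, hq]

end MDP

/-! ### Counting online iterations -/

theorem tendsto_count_atTop {p : ℕ → Prop} [DecidablePred p] (h : {i | p i}.Infinite) :
    Tendsto (Nat.count p) atTop atTop :=
  tendsto_atTop_atTop_of_monotone (Nat.count_monotone p) fun n =>
    ⟨Nat.nth p n, (Nat.count_nth_of_infinite h n).ge⟩

theorem onlineCount_succ (K M t : ℕ) :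
    onlineCount K M (t + 1) = onlineCount K M t + if IsOnline K M t then 1 else 0 :=
  Nat.count_succ _ _

theorem onlineCount_succ_of_online {K M t : ℕ} (h : IsOnline K M t) :
    onlineCount K M (t + 1) = onlineCount K M t + 1 := by rw [onlineCount_succ, if_pos h]

theorem onlineCount_succ_of_not_online {K M t : ℕ} (h : ¬ IsOnline K M t) :
    onlineCount K M (t + 1) = onlineCount K M t := by rw [onlineCount_succ, if_neg h, add_zero]

theorem tendsto_onlineCount {K M : ℕ} (hK : 0 < K) : Tendsto (onlineCount K M) atTop atTop := by
  refine tendsto_count_atTop (Set.infinite_of_forall_exists_gt fun n => ?_)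
  refine ⟨(n + 1) * (K + M), ?_, ?_⟩
  · simpa [IsOnline] using hK
  · nlinarith

theorem onlineCount_pos {K M t : ℕ} (hK : 0 < K) (ht : ¬ IsOnline K M t) :
    0 < onlineCount K M t := by
  have h0 : IsOnline K M 0 := by simpa [IsOnline] using hK
  have ht0 : 1 ≤ t := Nat.one_le_iff_ne_zero.2 fun h => ht (h ▸ h0)
  calc 0 < onlineCount K M 1 := by rw [onlineCount_succ_of_online h0]; omega
    _ ≤ onlineCount K M t := Nat.count_monotone _ ht0

/-- Multiplying by a bounded measurable function preserves vanishing conditional expectation. -/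
theorem condExp_mul_ae_eq_zero {Ω : Type*} {m mΩ : MeasurableSpace Ω} {μ : Measure Ω}
    [IsFiniteMeasure μ] (hm : m ≤ mΩ) {g h : Ω → ℝ} {c : ℝ} (hg : Measurable[m] g)
    (hgc : ∀ ω, |g ω| ≤ c) (hi : Integrable h μ) (hh : μ[h | m] =ᵐ[μ] 0) :
    μ[fun ω => g ω * h ω | m] =ᵐ[μ] 0 := by
  have h1 := condExp_stronglyMeasurable_mul_of_bound hm hg.stronglyMeasurable hi c
    (ae_of_all μ hgc)
  filter_upwards [h1, hh] with ω h2 h3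
  change (μ[g * h | m]) ω = 0
  rw [h2]; simp [h3]

/-! ### Measurability and law of the stored transitions -/

namespace ReplayProcess

variable {Ω S A : Type*}

/-- Next state and reward of the `j`-th transition. -/
def outcome (D : ReplayProcess Ω S A) (j : ℕ) (ω : Ω) : S × ℝ :=
  (D.state (j + 1) ω, D.reward j ω)

theorem entry_of_online (D : ReplayProcess Ω S A) {K M t : ℕ} (h : IsOnline K M t) (ω : Ω) :
    D.entry K M t ω = onlineCount K M t := if_pos h

theorem entry_of_not_online (D : ReplayProcess Ω S A) {K M t : ℕ} (h : ¬ IsOnline K M t) (ω : Ω) :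
    D.entry K M t ω = D.index t ω := if_neg h

/-- All replayed transitions are in the buffer. -/
def IndexInBuffer (D : ReplayProcess Ω S A) (K M : ℕ) : Prop :=
  ∀ t ω, ¬ IsOnline K M t → D.index t ω < onlineCount K M t

theorem IndexInBuffer.entry_lt {D : ReplayProcess Ω S A} {K M : ℕ} (h : D.IndexInBuffer K M)
    (t : ℕ) (ω : Ω) : D.entry K M t ω < onlineCount K M (t + 1) := by
  by_cases ht : IsOnline K M t
  · rw [entry_of_online D ht, onlineCount_succ_of_online ht]; omega
  · rw [entry_of_not_online D ht, onlineCount_succ_of_not_online ht]; exact h t ω ht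

section Measurability

variable [MeasurableSpace S] [MeasurableSpace A] {mΩ : MeasurableSpace Ω}
  {D : ReplayProcess Ω S A} {𝓜 : MDP S A} {K M : ℕ} {μ : Measure Ω} {ℱ : Filtration ℕ mΩ}

/-- The next state of a transition stored in iteration `t` is the current state of iteration `t +
1`, so the whole transition is known at `ℱ (t + 1)`, whether or not that iteration is online. -/
theorem IsRun.measurable_buffer (hD : D.IsRun 𝓜 K M μ ℱ) (t : ℕ) :
    ∀ j < onlineCount K M t, Measurable[ℱ t] (D.state j) ∧ Measurable[ℱ t] (D.action j) ∧
      Measurable[ℱ t] (D.outcome j) := by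
  induction t with
  | zero => intro j hj; simp [onlineCount] at hj
  | succ t ih =>
    intro j hj
    have hle : ℱ t ≤ ℱ (t + 1) := ℱ.mono t.le_succ
    by_cases h : j < onlineCount K M t
    · obtain ⟨h1, h2, h3⟩ := ih j h
      exact ⟨h1.mono hle le_rfl, h2.mono hle le_rfl, h3.mono hle le_rfl⟩
    · by_cases ht : IsOnline K M t
      · have hc := onlineCount_succ_of_online ht
        obtain rfl : j = onlineCount K M t := by omega
        refine ⟨(hD.measurable_state t).mono hle le_rfl,
          (hD.measurable_action t ht).mono hle le_rfl, ?_⟩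
        have h1 := hD.measurable_state (t + 1)
        rw [hc] at h1
        exact h1.prodMk (hD.measurable_reward t ht)
      · rw [onlineCount_succ_of_not_online ht] at hj
        exact absurd hj h

theorem IsRun.measurable_entry (hD : D.IsRun 𝓜 K M μ ℱ) (t : ℕ) :
    Measurable[ℱ (t + 1)] (D.entry K M t) := by
  by_cases ht : IsOnline K M t
  · have : D.entry K M t = fun _ => onlineCount K M t := funext (D.entry_of_online ht)
    rw [this]; exact measurable_const
  · have : D.entry K M t = D.index t := funext (D.entry_of_not_online ht)
    rw [this]; exact hD.measurable_index t ht

/-- The position is random but has finitely many possible values, so preimages are finite unions.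
The buffer condition is needed at every `ω`: a position beyond the buffer would refer to data not
yet observed. -/
theorem IsRun.measurable_comp_entry (hD : D.IsRun 𝓜 K M μ ℱ) (hI : D.IndexInBuffer K M) (t : ℕ)
    {β : Type*} [MeasurableSpace β] {X : ℕ → Ω → β}
    (hX : ∀ j < onlineCount K M (t + 1), Measurable[ℱ (t + 1)] (X j)) :
    Measurable[ℱ (t + 1)] (fun ω => X (D.entry K M t ω) ω) := by
  intro B hB
  have h1 : (fun ω => X (D.entry K M t ω) ω) ⁻¹' B =
      ⋃ j ∈ Finset.range (onlineCount K M (t + 1)), D.entry K M t ⁻¹' {j} ∩ X j ⁻¹' B := by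
    ext ω
    simp only [Set.mem_preimage, Set.mem_iUnion, Finset.mem_range, Set.mem_inter_iff,
      Set.mem_singleton_iff, exists_prop]
    exact ⟨fun h => ⟨_, hI.entry_lt t ω, rfl, h⟩, fun ⟨j, _, h2, h3⟩ => h2 ▸ h3⟩
  rw [h1]
  refine Finset.measurableSet_biUnion _ fun j hj => MeasurableSet.inter ?_ ?_
  · exact hD.measurable_entry t (measurableSet_singleton j)
  · exact hX j (Finset.mem_range.1 hj) hB

/-- On an event of the past on which the pair `(s, a)` is visited, the outcome has law
`law s a`. -/
theorem IsRun.map_outcome_restrict [IsProbabilityMeasure μ] (hD : D.IsRun 𝓜 K M μ ℱ) {t : ℕ} (ht : IsOnline K M t)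
    {s : S} {a : A} {H : Set Ω} (hH : MeasurableSet[ℱ t] H)
    (hs : ∀ ω ∈ H, D.state (onlineCount K M t) ω = s)
    (ha : ∀ ω ∈ H, D.action (onlineCount K M t) ω = a) :
    (μ.restrict H).map (D.outcome (onlineCount K M t)) = μ H • 𝓜.law s a := by
  have := 𝓜.isProbabilityMeasure_law s a
  have hZ : Measurable (D.outcome (onlineCount K M t)) :=
    ((hD.measurable_buffer (t + 1) _ (by rw [onlineCount_succ_of_online ht]; omega)).2.2).mono
      (ℱ.le _) le_rfl
  ext B hB
  rw [Measure.map_apply hZ hB, Measure.restrict_apply (hZ hB), Measure.smul_apply, smul_eq_mul]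
  have hmB := hZ hB
  have h1 : ∫ ω in H, (μ⟦D.outcome (onlineCount K M t) ⁻¹' B | ℱ t⟧) ω ∂μ =
      ∫ ω in H, (D.outcome (onlineCount K M t) ⁻¹' B).indicator (1 : Ω → ℝ) ω ∂μ :=
    setIntegral_condExp (ℱ.le t) ((integrable_const 1).indicator hmB) hH
  have h2 : ∫ ω in H, (μ⟦D.outcome (onlineCount K M t) ⁻¹' B | ℱ t⟧) ω ∂μ =
      ∫ ω in H, (𝓜.law s a).real B ∂μ := by
    refine setIntegral_congr_ae (ℱ.le t _ hH) ?_
    filter_upwards [hD.online_law t ht B hB] with ω h3 h4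
    rw [← hs ω h4, ← ha ω h4]
    exact h3
  rw [h2, integral_indicator_one hmB, setIntegral_const, smul_eq_mul,
    measureReal_restrict_apply hmB] at h1
  rw [← ENNReal.toReal_eq_toReal_iff' (measure_ne_top _ _)
    (ENNReal.mul_ne_top (measure_ne_top _ _) (measure_ne_top _ _)), ENNReal.toReal_mul]
  exact h1.symm

/-- The rewards are bounded. -/
theorem IsRun.ae_abs_reward_le [Countable S] [Countable A] [MeasurableSingletonClass S]
    [MeasurableSingletonClass A] [IsProbabilityMeasure μ] (hD : D.IsRun 𝓜 K M μ ℱ) (hK : 0 < K) :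
    ∀ᵐ ω ∂μ, ∀ j, |D.reward j ω| ≤ 𝓜.Rmax := by
  refine ae_all_iff.2 fun j => ?_
  have hinf : {t | IsOnline K M t}.Infinite := by
    by_contra h
    obtain ⟨t, ht⟩ := ((tendsto_onlineCount (M := M) hK).eventually_gt_atTop
      (Set.not_infinite.1 h).toFinset.card).exists
    exact absurd (Nat.count_le_card (Set.not_infinite.1 h) t) (not_le.2 ht)
  -- The iteration in which the `j`-th transition is stored.
  set t := Nat.nth (IsOnline K M) j with htdef
  have ht : IsOnline K M t := Nat.nth_mem_of_infinite hinf j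
  have hc : onlineCount K M t = j := Nat.count_nth_of_infinite hinf j
  have hZ : Measurable (D.outcome j) :=
    ((hD.measurable_buffer (t + 1) j (by rw [onlineCount_succ_of_online ht]; omega)).2.2).mono
      (ℱ.le _) le_rfl
  have hBm : MeasurableSet {x : S × ℝ | |x.2| ≤ 𝓜.Rmax} :=
    measurable_snd.abs measurableSet_Iic
  have key : ∀ s a, ∀ᵐ ω ∂μ, D.state j ω = s ∧ D.action j ω = a → |D.reward j ω| ≤ 𝓜.Rmax := by
    intro s a
    set V : Set Ω := D.state j ⁻¹' {s} ∩ D.action j ⁻¹' {a} with hV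
    have hVm : MeasurableSet[ℱ t] V := by
      have h1 := hD.measurable_state t
      have h2 := hD.measurable_action t ht
      rw [hc] at h1 h2
      exact (h1 (measurableSet_singleton s)).inter (h2 (measurableSet_singleton a))
    have h1 := hD.map_outcome_restrict ht (s := s) (a := a) hVm
      (fun ω h => hc ▸ h.1) (fun ω h => hc ▸ h.2)
    rw [hc] at h1
    have h2 : ∀ᵐ x ∂((μ.restrict V).map (D.outcome j)), |x.2| ≤ 𝓜.Rmax := by
      rw [h1]; exact Measure.ae_smul_measure (𝓜.abs_reward_le s a) _
    have h3 := (ae_map_iff hZ.aemeasurable hBm).1 h2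
    exact (ae_restrict_iff' (ℱ.le t _ hVm)).1 h3
  filter_upwards [ae_all_iff.2 fun s => ae_all_iff.2 (key s)] with ω hω
  exact hω _ _ ⟨rfl, rfl⟩

end Measurability

/-! ### Innovations and their conditional means -/

variable [DecidableEq S] [DecidableEq A]

/-- The indicator of the event that the `j`-th transition starts with `(s, a)`. -/
def visit (D : ReplayProcess Ω S A) (s : S) (a : A) (j : ℕ) (ω : Ω) : ℝ :=
  if D.state j ω = s ∧ D.action j ω = a then 1 else 0

/-- The number of transitions from `(s, a)` in the buffer before iteration `t`. -/
def visitCount (D : ReplayProcess Ω S A) (K M : ℕ) (s : S) (a : A) (t : ℕ) (ω : Ω) : ℕ :=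
  Nat.count (fun j => D.state j ω = s ∧ D.action j ω = a) (onlineCount K M t)

/-- The mean of `f` over the outcomes of the transitions from `(s, a)` in the buffer. -/
noncomputable def bufferMean (D : ReplayProcess Ω S A) (K M : ℕ) (s : S) (a : A) (f : S × ℝ → ℝ)
    (t : ℕ) (ω : Ω) : ℝ :=
  (∑ j ∈ Finset.range (onlineCount K M t), D.visit s a j ω * f (D.outcome j ω)) /
    D.visitCount K M s a t ω

theorem visit_nonneg (D : ReplayProcess Ω S A) (s : S) (a : A) (j : ℕ) (ω : Ω) :
    0 ≤ D.visit s a j ω := by unfold visit; positivity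

theorem visit_le_one (D : ReplayProcess Ω S A) (s : S) (a : A) (j : ℕ) (ω : Ω) :
    D.visit s a j ω ≤ 1 := by unfold visit; split_ifs <;> norm_num

theorem alpha_eq (D : ReplayProcess Ω S A) (K M t : ℕ) (ω : Ω) (s : S) (a : A) :
    D.alpha K M t ω s a = D.visit s a (D.entry K M t ω) ω * D.rate t ω s a := by
  simp [alpha, visit]

theorem sum_visit (D : ReplayProcess Ω S A) (K M : ℕ) (s : S) (a : A) (t : ℕ) (ω : Ω) :
    ∑ j ∈ Finset.range (onlineCount K M t), D.visit s a j ω = D.visitCount K M s a t ω := by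
  simp [visit, visitCount, Nat.count_eq_card_filter_range]

theorem abs_bufferMean_le (D : ReplayProcess Ω S A) (K M : ℕ) (s : S) (a : A) {f : S × ℝ → ℝ}
    {C : ℝ} (hf : ∀ x, |f x| ≤ C) (t : ℕ) (ω : Ω) : |D.bufferMean K M s a f t ω| ≤ C := by
  have hC : 0 ≤ C := (abs_nonneg _).trans (hf (D.outcome 0 ω))
  rw [bufferMean, abs_div, Nat.abs_cast]
  refine div_le_of_le_mul₀ (by positivity) hC ?_
  rw [← sum_visit, Finset.mul_sum]
  refine (Finset.abs_sum_le_sum_abs _ _).trans (Finset.sum_le_sum fun j _ => ?_)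
  rw [abs_mul, abs_of_nonneg (D.visit_nonneg s a j ω), mul_comm]
  exact mul_le_mul_of_nonneg_right (hf _) (D.visit_nonneg s a j ω)

theorem visitCount_mul_bufferMean (D : ReplayProcess Ω S A) (K M : ℕ) (s : S) (a : A)
    (f : S × ℝ → ℝ) (t : ℕ) (ω : Ω) :
    D.visitCount K M s a t ω * D.bufferMean K M s a f t ω =
      ∑ j ∈ Finset.range (onlineCount K M t), D.visit s a j ω * f (D.outcome j ω) := by
  rcases eq_or_ne (D.visitCount K M s a t ω : ℝ) 0 with h | h
  -- Without visits both sides vanish, so the value of the mean under division by zero does not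
  -- matter.
  · rw [h, zero_mul, eq_comm]
    refine Finset.sum_eq_zero fun j hj => ?_
    rw [← sum_visit, Finset.sum_eq_zero_iff_of_nonneg fun j _ => D.visit_nonneg s a j ω] at h
    rw [h j hj, zero_mul]
  · rw [bufferMean, mul_div_cancel₀ _ h]

variable [MeasurableSpace S]

/-- The conditional mean of `f (outcome)` if iteration `t` updates `(s, a)`. -/
noncomputable def condMean (D : ReplayProcess Ω S A) (𝓜 : MDP S A) (K M : ℕ) (s : S) (a : A)
    (f : S × ℝ → ℝ) (t : ℕ) (ω : Ω) : ℝ :=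
  if IsOnline K M t then ∫ x, f x ∂(𝓜.law s a) else D.bufferMean K M s a f t ω

/-- The deviation of `f (outcome)` from its conditional mean, when `(s, a)` is updated. -/
noncomputable def innovation (D : ReplayProcess Ω S A) (𝓜 : MDP S A) (K M : ℕ) (s : S) (a : A)
    (f : S × ℝ → ℝ) (t : ℕ) (ω : Ω) : ℝ :=
  D.visit s a (D.entry K M t ω) ω *
    (f (D.outcome (D.entry K M t ω) ω) - D.condMean 𝓜 K M s a f t ω)

theorem abs_condMean_le (D : ReplayProcess Ω S A) (𝓜 : MDP S A) (K M : ℕ) (s : S) (a : A)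
    {f : S × ℝ → ℝ} {C : ℝ} (hf : ∀ x, |f x| ≤ C) (t : ℕ) (ω : Ω) :
    |D.condMean 𝓜 K M s a f t ω| ≤ C := by
  unfold condMean
  split_ifs
  · exact 𝓜.abs_integral_law_le s a hf
  · exact D.abs_bufferMean_le K M s a hf t ω

theorem abs_innovation_le (D : ReplayProcess Ω S A) (𝓜 : MDP S A) (K M : ℕ) (s : S) (a : A)
    {f : S × ℝ → ℝ} {C : ℝ} (hf : ∀ x, |f x| ≤ C) (t : ℕ) (ω : Ω) :
    |D.innovation 𝓜 K M s a f t ω| ≤ D.visit s a (D.entry K M t ω) ω * (2 * C) := by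
  rw [innovation, abs_mul, abs_of_nonneg (D.visit_nonneg _ _ _ _)]
  refine mul_le_mul_of_nonneg_left ?_ (D.visit_nonneg _ _ _ _)
  have h1 := abs_sub (f (D.outcome (D.entry K M t ω) ω)) (D.condMean 𝓜 K M s a f t ω)
  have h2 := hf (D.outcome (D.entry K M t ω) ω)
  have h3 := D.abs_condMean_le 𝓜 K M s a hf t ω
  linarith

theorem abs_innovation_le' (D : ReplayProcess Ω S A) (𝓜 : MDP S A) (K M : ℕ) (s : S) (a : A)
    {f : S × ℝ → ℝ} {C : ℝ} (hf : ∀ x, |f x| ≤ C) (t : ℕ) (ω : Ω) :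
    |D.innovation 𝓜 K M s a f t ω| ≤ 2 * C := by
  have hC : 0 ≤ C := (abs_nonneg _).trans (hf (D.outcome 0 ω))
  exact (D.abs_innovation_le 𝓜 K M s a hf t ω).trans
    (mul_le_of_le_one_left (by positivity) (D.visit_le_one _ _ _ _))

variable [MeasurableSpace A] [MeasurableSingletonClass S] [MeasurableSingletonClass A]
  {mΩ : MeasurableSpace Ω}
  {D : ReplayProcess Ω S A} {𝓜 : MDP S A} {K M : ℕ} {μ : Measure Ω} {ℱ : Filtration ℕ mΩ}

theorem measurable_visit {m : MeasurableSpace Ω} {j : ℕ} (h1 : Measurable[m] (D.state j))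
    (h2 : Measurable[m] (D.action j)) (s : S) (a : A) : Measurable[m] (D.visit s a j) :=
  Measurable.ite ((h1 (measurableSet_singleton s)).inter (h2 (measurableSet_singleton a)))
    measurable_const measurable_const

theorem IsRun.measurable_visitCount (hD : D.IsRun 𝓜 K M μ ℱ) (s : S) (a : A) (t : ℕ) :
    Measurable[ℱ t] fun ω => (D.visitCount K M s a t ω : ℝ) := by
  simp only [← sum_visit]
  refine Finset.measurable_sum _ fun j hj => ?_
  obtain ⟨h1, h2, -⟩ := hD.measurable_buffer t j (Finset.mem_range.1 hj)
  exact measurable_visit h1 h2 s a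

theorem IsRun.measurable_condMean (hD : D.IsRun 𝓜 K M μ ℱ) (s : S) (a : A) {f : S × ℝ → ℝ}
    (hf : Measurable f) (t : ℕ) : Measurable[ℱ t] (D.condMean 𝓜 K M s a f t) := by
  unfold condMean
  split_ifs
  · exact measurable_const
  · refine Measurable.div ?_ (hD.measurable_visitCount s a t)
    refine Finset.measurable_sum _ fun j hj => ?_
    obtain ⟨h1, h2, h3⟩ := hD.measurable_buffer t j (Finset.mem_range.1 hj)
    exact (measurable_visit h1 h2 s a).mul (hf.comp h3)

theorem IsRun.measurable_innovation (hD : D.IsRun 𝓜 K M μ ℱ) (hI : D.IndexInBuffer K M)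
    (s : S) (a : A) {f : S × ℝ → ℝ} (hf : Measurable f) (t : ℕ) :
    Measurable[ℱ (t + 1)] (D.innovation 𝓜 K M s a f t) := by
  refine hD.measurable_comp_entry hI t
    (X := fun j ω => D.visit s a j ω * (f (D.outcome j ω) - D.condMean 𝓜 K M s a f t ω))
    fun j hj => ?_
  obtain ⟨h1, h2, h3⟩ := hD.measurable_buffer (t + 1) j hj
  exact (measurable_visit h1 h2 s a).mul ((hf.comp h3).sub
    ((hD.measurable_condMean s a hf t).mono (ℱ.mono t.le_succ) le_rfl))

variable [IsProbabilityMeasure μ]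

theorem IsRun.integrable_innovation (hD : D.IsRun 𝓜 K M μ ℱ) (hI : D.IndexInBuffer K M)
    (s : S) (a : A) {f : S × ℝ → ℝ} (hf : Measurable f) {C : ℝ} (hC : ∀ x, |f x| ≤ C) (t : ℕ) :
    Integrable (D.innovation 𝓜 K M s a f t) μ :=
  Integrable.of_bound
    ((hD.measurable_innovation hI s a hf t).mono (ℱ.le _) le_rfl).aestronglyMeasurable (2 * C)
    (ae_of_all _ fun ω => D.abs_innovation_le' 𝓜 K M s a hC t ω)

/-- On an event of the past intersected with a visit to `(s, a)`, the outcome is distributed as a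
multiple of `law s a` (`map_outcome_restrict`), against which `f` minus its mean integrates to zero.
-/
theorem IsRun.condExp_innovation_online (hD : D.IsRun 𝓜 K M μ ℱ) (hI : D.IndexInBuffer K M)
    (s : S) (a : A) {f : S × ℝ → ℝ} (hf : Measurable f) {C : ℝ} (hC : ∀ x, |f x| ≤ C) {t : ℕ}
    (ht : IsOnline K M t) : μ[D.innovation 𝓜 K M s a f t | ℱ t] =ᵐ[μ] 0 := by
  have := 𝓜.isProbabilityMeasure_law s a
  set c := onlineCount K M t with hc
  have hZ : Measurable (D.outcome c) :=
    ((hD.measurable_buffer (t + 1) _ (by rw [onlineCount_succ_of_online ht]; omega)).2.2).mono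
      (ℱ.le _) le_rfl
  have hfi : Integrable f (𝓜.law s a) :=
    Integrable.of_bound hf.aestronglyMeasurable C (ae_of_all _ hC)
  set V : Set Ω := D.state c ⁻¹' {s} ∩ D.action c ⁻¹' {a} with hV
  have hVm : MeasurableSet[ℱ t] V :=
    (hD.measurable_state t (measurableSet_singleton s)).inter
      (hD.measurable_action t ht (measurableSet_singleton a))
  have hinn : D.innovation 𝓜 K M s a f t =
      V.indicator fun ω => f (D.outcome c ω) - ∫ x, f x ∂(𝓜.law s a) := by
    ext ω
    by_cases h : ω ∈ V
    · have h' : D.state c ω = s ∧ D.action c ω = a := h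
      simp [innovation, entry_of_online D ht, visit, condMean, ht, ← hc, h, h']
    · have h' : ¬ (D.state c ω = s ∧ D.action c ω = a) := h
      simp [innovation, entry_of_online D ht, visit, ← hc, h, h']
  refine (ae_eq_condExp_of_forall_setIntegral_eq (ℱ.le t)
    (hD.integrable_innovation hI s a hf hC t) (fun _ _ _ => integrableOn_zero) ?_
    aestronglyMeasurable_zero).symm
  intro H hH _
  have h1 := hD.map_outcome_restrict ht (s := s) (a := a) (hH.inter hVm)
    (fun ω h => h.2.1) (fun ω h => h.2.2)
  have h2 : ∫ ω in H ∩ V, (f (D.outcome c ω) - ∫ x, f x ∂(𝓜.law s a)) ∂μ =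
      ∫ y, (f y - ∫ x, f x ∂(𝓜.law s a)) ∂((μ.restrict (H ∩ V)).map (D.outcome c)) :=
    (integral_map hZ.aemeasurable (hf.sub_const _).aestronglyMeasurable).symm
  rw [hinn, setIntegral_indicator (ℱ.le t _ hVm), h2, h1, integral_smul_measure,
    integral_sub hfi (integrable_const _)]
  simp

/-- Given the past only the position is random. Averaging over all positions leaves `1 / c` times
the sum, over the stored visits to `(s, a)`, of deviations from their own mean. The draw also
decides whether `(s, a)` is updated, which is why the visit indicator belongs to the innovation and
not to its coefficient. -/
theorem IsRun.condExp_innovation_replay (hD : D.IsRun 𝓜 K M μ ℱ) (hI : D.IndexInBuffer K M)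
    (s : S) (a : A) {f : S × ℝ → ℝ} (hf : Measurable f) {C : ℝ} (hC : ∀ x, |f x| ≤ C) {t : ℕ}
    (ht : ¬ IsOnline K M t) : μ[D.innovation 𝓜 K M s a f t | ℱ t] =ᵐ[μ] 0 := by
  set c := onlineCount K M t with hc
  set G : ℕ → Ω → ℝ := fun j ω =>
    D.visit s a j ω * (f (D.outcome j ω) - D.condMean 𝓜 K M s a f t ω) with hG
  have hGm : ∀ j ∈ Finset.range c, Measurable[ℱ t] (G j) := fun j hj => by
    obtain ⟨h1, h2, h3⟩ := hD.measurable_buffer t j (Finset.mem_range.1 hj)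
    exact (measurable_visit h1 h2 s a).mul ((hf.comp h3).sub (hD.measurable_condMean s a hf t))
  have hGb : ∀ j ω, |G j ω| ≤ 2 * C := by
    intro j ω
    have h1 := abs_sub (f (D.outcome j ω)) (D.condMean 𝓜 K M s a f t ω)
    have h2 := hC (D.outcome j ω)
    have h3 := D.abs_condMean_le 𝓜 K M s a hC t ω
    rw [hG, abs_mul, abs_of_nonneg (D.visit_nonneg _ _ _ _)]
    calc _ ≤ 1 * (2 * C) := mul_le_mul (D.visit_le_one _ _ _ _) (by linarith) (abs_nonneg _)
          zero_le_one
      _ = 2 * C := one_mul _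
  have hJ : ∀ j, MeasurableSet (D.index t ⁻¹' {j}) := fun j =>
    ℱ.le _ _ (hD.measurable_index t ht (measurableSet_singleton j))
  set I : ℕ → Ω → ℝ := fun j => (D.index t ⁻¹' {j}).indicator fun _ => (1 : ℝ) with hIdef
  have hIi : ∀ j, Integrable (I j) μ := fun j => (integrable_const 1).indicator (hJ j)
  -- Split by drawn position: `G j` is known at `ℱ t`, and only the indicator `I j` depends on the
  -- draw.
  have hinn : D.innovation 𝓜 K M s a f t = ∑ j ∈ Finset.range c, G j * I j := by
    ext ω
    rw [Finset.sum_apply, Finset.sum_eq_single (D.index t ω)]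
    · simp [innovation, entry_of_not_online D ht, hG, hIdef]
    · intro j _ hj
      have : ω ∉ D.index t ⁻¹' {j} := fun h => hj h.symm
      simp [hIdef, this]
    · intro h
      exact absurd (Finset.mem_range.2 (hI t ω ht)) h
  have hGI : ∀ j ∈ Finset.range c, Integrable (G j * I j) μ := fun j hj =>
    (hIi j).bdd_mul ((hGm j hj).mono (ℱ.le _) le_rfl).aestronglyMeasurable
      (ae_of_all _ fun ω => hGb j ω)
  have hterm : ∀ j ∈ Finset.range c,
      μ[G j * I j | ℱ t] =ᵐ[μ] fun ω => G j ω * (1 / (c : ℝ)) := by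
    intro j hj
    filter_upwards [condExp_stronglyMeasurable_mul_of_bound (ℱ.le t)
      (hGm j hj).stronglyMeasurable (hIi j) _ (ae_of_all μ fun ω => hGb j ω),
      hD.replay_law t ht j (Finset.mem_range.1 hj)] with ω h1 h2
    rw [h1, Pi.mul_apply]
    exact congrArg _ h2
  rw [hinn]
  refine (condExp_finsetSum hGI _).trans ?_
  filter_upwards [(ae_ball_iff (Finset.range c).countable_toSet).2 hterm] with ω hω
  rw [Finset.sum_apply, Finset.sum_congr rfl fun j hj => hω j hj, ← Finset.sum_mul]
  have h1 : ∑ j ∈ Finset.range c, G j ω = 0 := by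
    simp only [hG, mul_sub, Finset.sum_sub_distrib, ← Finset.sum_mul]
    rw [hc, sum_visit, condMean, if_neg ht, visitCount_mul_bufferMean, sub_self]
  rw [h1, zero_mul]; rfl

theorem IsRun.condExp_innovation (hD : D.IsRun 𝓜 K M μ ℱ) (hI : D.IndexInBuffer K M)
    (s : S) (a : A) {f : S × ℝ → ℝ} (hf : Measurable f) {C : ℝ} (hC : ∀ x, |f x| ≤ C) (t : ℕ) :
    μ[D.innovation 𝓜 K M s a f t | ℱ t] =ᵐ[μ] 0 := by
  by_cases ht : IsOnline K M t
  · exact hD.condExp_innovation_online hI s a hf hC ht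
  · exact hD.condExp_innovation_replay hI s a hf hC ht

end ReplayProcess

/-! ### Strong law of large numbers for the buffer -/

namespace ReplayProcess

variable {Ω S A : Type*} [DecidableEq S] [DecidableEq A]

theorem visitCount_succ (D : ReplayProcess Ω S A) (K M : ℕ) (s : S) (a : A) (t : ℕ) (ω : Ω) :
    D.visitCount K M s a (t + 1) ω = D.visitCount K M s a t ω +
      if IsOnline K M t ∧ D.state (onlineCount K M t) ω = s ∧ D.action (onlineCount K M t) ω = a
      then 1 else 0 := by
  unfold visitCount
  by_cases ht : IsOnline K M t
  · rw [onlineCount_succ_of_online ht, Nat.count_succ]; simp [ht]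
  · rw [onlineCount_succ_of_not_online ht]; simp [ht]

/-- The weight of the newest transition in the mean over the transitions from `(s, a)`. -/
noncomputable def meanWeight (D : ReplayProcess Ω S A) (K M : ℕ) (s : S) (a : A) (t : ℕ) (ω : Ω) :
    ℝ :=
  if IsOnline K M t ∧ D.state (onlineCount K M t) ω = s ∧ D.action (onlineCount K M t) ω = a
  then 1 / ((D.visitCount K M s a t ω : ℝ) + 1) else 0

theorem meanWeight_nonneg (D : ReplayProcess Ω S A) (K M : ℕ) (s : S) (a : A) (t : ℕ) (ω : Ω) :
    0 ≤ D.meanWeight K M s a t ω := by unfold meanWeight; positivity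

theorem meanWeight_le_one (D : ReplayProcess Ω S A) (K M : ℕ) (s : S) (a : A) (t : ℕ) (ω : Ω) :
    D.meanWeight K M s a t ω ≤ 1 := by
  unfold meanWeight
  split_ifs
  · rw [div_le_one (by positivity)]
    linarith [Nat.cast_nonneg (α := ℝ) (D.visitCount K M s a t ω)]
  · exact zero_le_one

/-- The nonzero weights along a path are `1, 1/2, 1/3, …` in order of visits. Exponent `1` gives
divergence by the harmonic series, exponent `2` square summability. -/
theorem sum_meanWeight_pow (D : ReplayProcess Ω S A) (K M : ℕ) (s : S) (a : A) (t : ℕ) (ω : Ω)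
    {p : ℕ} (hp : p ≠ 0) :
    ∑ k ∈ Finset.range t, D.meanWeight K M s a k ω ^ p =
      ∑ n ∈ Finset.range (D.visitCount K M s a t ω), (1 / ((n : ℝ) + 1)) ^ p := by
  induction t with
  | zero => simp [visitCount, onlineCount]
  | succ t ih =>
    rw [Finset.sum_range_succ, ih, visitCount_succ, meanWeight]
    split_ifs
    · rw [Finset.sum_range_succ]
    · simp [hp]

theorem tendsto_visitCount (D : ReplayProcess Ω S A) {K : ℕ} (M : ℕ) (hK : 0 < K) {s : S} {a : A}
    {ω : Ω} (h : {i : ℕ | D.state i ω = s ∧ D.action i ω = a}.Infinite) :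
    Tendsto (fun t => D.visitCount K M s a t ω) atTop atTop :=
  (tendsto_count_atTop h).comp (tendsto_onlineCount hK)

theorem tendsto_sum_meanWeight (D : ReplayProcess Ω S A) {K : ℕ} (M : ℕ) (hK : 0 < K) {s : S}
    {a : A} {ω : Ω} (h : {i : ℕ | D.state i ω = s ∧ D.action i ω = a}.Infinite) :
    Tendsto (fun t => ∑ k ∈ Finset.range t, D.meanWeight K M s a k ω) atTop atTop := by
  have h1 := fun t => D.sum_meanWeight_pow K M s a t ω one_ne_zero
  simp only [pow_one] at h1
  simp only [h1]
  exact Real.tendsto_sum_range_one_div_nat_succ_atTop.comp (D.tendsto_visitCount M hK h)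

theorem summable_meanWeight_sq (D : ReplayProcess Ω S A) (K M : ℕ) (s : S) (a : A) (ω : Ω) :
    Summable fun t => D.meanWeight K M s a t ω ^ 2 := by
  have h1 : Summable fun n : ℕ => (1 / ((n : ℝ) + 1)) ^ 2 := by
    have := (summable_nat_add_iff 1).2 (Real.summable_one_div_nat_pow.2 one_lt_two)
    simpa [div_pow] using this
  refine summable_of_sum_range_le (c := ∑' n : ℕ, (1 / ((n : ℝ) + 1)) ^ 2)
    (fun _ => sq_nonneg _) fun t => ?_
  rw [D.sum_meanWeight_pow K M s a t ω two_ne_zero]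
  exact h1.sum_le_tsum _ fun _ _ => sq_nonneg _

variable [MeasurableSpace S]

/-- Recursive form of an empirical mean. The weight vanishes except at online visits, where the
innovation is centred at the true mean, so the error is a noisy relaxation towards `0`. -/
theorem bufferMean_succ (D : ReplayProcess Ω S A) (𝓜 : MDP S A) (K M : ℕ) (s : S) (a : A)
    (f : S × ℝ → ℝ) (t : ℕ) (ω : Ω) :
    D.bufferMean K M s a f (t + 1) ω - ∫ x, f x ∂(𝓜.law s a) =
      (1 - D.meanWeight K M s a t ω) *
          (D.bufferMean K M s a f t ω - ∫ x, f x ∂(𝓜.law s a)) +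
        D.meanWeight K M s a t ω * D.innovation 𝓜 K M s a f t ω := by
  have hN := D.visitCount_mul_bufferMean K M s a f t ω
  by_cases h : IsOnline K M t ∧ D.state (onlineCount K M t) ω = s ∧
      D.action (onlineCount K M t) ω = a
  · have h1 : (D.visitCount K M s a t ω : ℝ) + 1 ≠ 0 := by positivity
    rw [bufferMean, visitCount_succ, if_pos h, onlineCount_succ_of_online h.1,
      Finset.sum_range_succ, ← hN]
    simp only [meanWeight, if_pos h, innovation, entry_of_online D h.1, visit, if_pos h.2,
      condMean, if_pos h.1]
    push_cast
    field_simp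
    ring
  · have h1 : D.bufferMean K M s a f (t + 1) ω = D.bufferMean K M s a f t ω := by
      rw [bufferMean, bufferMean, visitCount_succ, if_neg h, add_zero]
      by_cases ht : IsOnline K M t
      · have h2 : ¬ (D.state (onlineCount K M t) ω = s ∧ D.action (onlineCount K M t) ω = a) :=
          fun h' => h ⟨ht, h'⟩
        rw [onlineCount_succ_of_online ht, Finset.sum_range_succ]
        simp [visit, h2]
      · rw [onlineCount_succ_of_not_online ht]
    rw [h1, meanWeight, if_neg h]
    ring

variable [MeasurableSpace A] [MeasurableSingletonClass S] [MeasurableSingletonClass A]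
  {mΩ : MeasurableSpace Ω}
  {D : ReplayProcess Ω S A} {𝓜 : MDP S A} {K M : ℕ} {μ : Measure Ω} {ℱ : Filtration ℕ mΩ}

theorem IsRun.measurable_meanWeight (hD : D.IsRun 𝓜 K M μ ℱ) (s : S) (a : A) (t : ℕ) :
    Measurable[ℱ t] (D.meanWeight K M s a t) := by
  by_cases ht : IsOnline K M t
  · unfold meanWeight
    simp only [ht, true_and]
    refine Measurable.ite (((hD.measurable_state t) (measurableSet_singleton s)).inter
      ((hD.measurable_action t ht) (measurableSet_singleton a))) ?_ measurable_const
    exact measurable_const.div ((hD.measurable_visitCount s a t).add_const 1)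
  · unfold meanWeight
    simp only [ht, false_and, if_false]
    exact measurable_const

variable [IsProbabilityMeasure μ]

/-- The strong law of large numbers for the memory buffer. -/
theorem IsRun.tendsto_condMean (hD : D.IsRun 𝓜 K M μ ℱ) (hI : D.IndexInBuffer K M) (hK : 0 < K)
    (s : S) (a : A) {f : S × ℝ → ℝ} (hf : Measurable f) {C : ℝ} (hC : ∀ x, |f x| ≤ C) :
    ∀ᵐ ω ∂μ, {i : ℕ | D.state i ω = s ∧ D.action i ω = a}.Infinite →
      Tendsto (fun t => D.condMean 𝓜 K M s a f t ω) atTop (𝓝 (∫ x, f x ∂(𝓜.law s a))) := by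
  have hwabs : ∀ t ω, |D.meanWeight K M s a t ω| ≤ 1 := fun t ω => by
    rw [abs_of_nonneg (D.meanWeight_nonneg K M s a t ω)]
    exact D.meanWeight_le_one K M s a t ω
  have hmain := ae_exists_tendsto_sum_of_summable_sq (μ := μ) (ℱ := ℱ) (C := 2 * C)
    (ξ := fun t ω => D.meanWeight K M s a t ω * D.innovation 𝓜 K M s a f t ω)
    (fun t => ((hD.measurable_meanWeight s a t).mono (ℱ.mono t.le_succ) le_rfl).mul
      (hD.measurable_innovation hI s a hf t))
    (fun t ω => by
      rw [abs_mul]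
      exact (mul_le_of_le_one_left (abs_nonneg _) (hwabs t ω)).trans
        (D.abs_innovation_le' 𝓜 K M s a hC t ω))
    (fun t => condExp_mul_ae_eq_zero (ℱ.le t) (hD.measurable_meanWeight s a t) (hwabs t)
      (hD.integrable_innovation hI s a hf hC t) (hD.condExp_innovation hI s a hf hC t))
  filter_upwards [hmain] with ω hω hinf
  have hsum : Summable fun t =>
      (D.meanWeight K M s a t ω * D.innovation 𝓜 K M s a f t ω) ^ 2 := by
    refine Summable.of_nonneg_of_le (fun _ => sq_nonneg _) (fun t => ?_)
      ((D.summable_meanWeight_sq K M s a ω).mul_right ((2 * C) ^ 2))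
    rw [mul_pow]
    refine mul_le_mul_of_nonneg_left ?_ (sq_nonneg _)
    exact sq_le_sq.2 ((D.abs_innovation_le' 𝓜 K M s a hC t ω).trans (le_abs_self _))
  have hbuf : Tendsto (fun t => D.bufferMean K M s a f t ω) atTop
      (𝓝 (∫ x, f x ∂(𝓜.law s a))) := by
    refine Metric.tendsto_atTop'.2 fun ε hε => ?_
    have h1 := eventually_abs_le_add_of_noisy_relaxation
      (x := fun t => D.bufferMean K M s a f t ω - ∫ x, f x ∂(𝓜.law s a)) (F := fun _ => 0) (c := 0)
      (fun t => D.meanWeight_nonneg K M s a t ω)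
      (Eventually.of_forall fun t => D.meanWeight_le_one K M s a t ω)
      (D.tendsto_sum_meanWeight M hK hinf) (hω hsum) (by simp)
      (Eventually.of_forall fun t => by rw [D.bufferMean_succ 𝓜]; ring) (half_pos hε)
    obtain ⟨N, hN⟩ := eventually_atTop.1 h1
    refine ⟨N, fun t ht => ?_⟩
    have h2 := hN t ht.le
    rw [Real.dist_eq]
    linarith
  refine Metric.tendsto_atTop'.2 fun ε hε => ?_
  obtain ⟨N, hN⟩ := Metric.tendsto_atTop'.1 hbuf ε hε
  refine ⟨N, fun t ht => ?_⟩
  unfold condMean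
  -- In online iterations the conditional mean equals the limit exactly.
  split_ifs
  · simpa using hε
  · exact hN t ht

end ReplayProcess

/-! ### Bounded test functions: clamped reward and next-state indicators -/

/-- The reward, cut off at its bound. -/
noncomputable def MDP.clampedReward {S A : Type*} [MeasurableSpace S] (𝓜 : MDP S A)
    (y : S × ℝ) : ℝ :=
  max (-|𝓜.Rmax|) (min |𝓜.Rmax| y.2)

/-- The indicator of the next state `x`. -/
def nextState {S : Type*} [DecidableEq S] (x : S) (y : S × ℝ) : ℝ := if y.1 = x then 1 else 0

theorem abs_nextState_le {S : Type*} [DecidableEq S] (x : S) (y : S × ℝ) :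
    |nextState x y| ≤ 1 := by unfold nextState; split_ifs <;> simp

theorem sum_mul_nextState {S : Type*} [DecidableEq S] [Fintype S] (v : S → ℝ) (y : S × ℝ) :
    ∑ x, v x * nextState x y = v y.1 := by simp [nextState]

theorem measurable_nextState {S : Type*} [DecidableEq S] [MeasurableSpace S]
    [MeasurableSingletonClass S] (x : S) : Measurable (nextState x) :=
  Measurable.ite (measurable_fst (measurableSet_singleton x)) measurable_const measurable_const

namespace MDP

variable {S A : Type*} [MeasurableSpace S]

theorem abs_clampedReward_le (𝓜 : MDP S A) (y : S × ℝ) : |𝓜.clampedReward y| ≤ |𝓜.Rmax| :=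
  abs_le.2 ⟨le_max_left _ _, max_le (by linarith [abs_nonneg 𝓜.Rmax]) (min_le_left _ _)⟩

theorem measurable_clampedReward (𝓜 : MDP S A) : Measurable 𝓜.clampedReward :=
  measurable_const.max (measurable_const.min measurable_snd)

theorem clampedReward_eq (𝓜 : MDP S A) {y : S × ℝ} (hy : |y.2| ≤ 𝓜.Rmax) :
    𝓜.clampedReward y = y.2 := by
  obtain ⟨h1, h2⟩ := abs_le.1 (hy.trans (le_abs_self _))
  rw [clampedReward, min_eq_right h2, max_eq_right h1]

theorem integral_clampedReward (𝓜 : MDP S A) (s : S) (a : A) :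
    ∫ y, 𝓜.clampedReward y ∂(𝓜.law s a) = 𝓜.R s a := by
  refine integral_congr_ae ?_
  filter_upwards [𝓜.abs_reward_le s a] with y hy using 𝓜.clampedReward_eq hy

theorem integral_nextState [DecidableEq S] [MeasurableSingletonClass S] (𝓜 : MDP S A) (s : S)
    (a : A) (x : S) : ∫ y, nextState x y ∂(𝓜.law s a) = 𝓜.P s a x := by
  have h : nextState x = (Prod.fst ⁻¹' {x} : Set (S × ℝ)).indicator 1 := by
    ext y
    by_cases h : y.1 = x <;> simp [nextState, h]
  rw [h, integral_indicator_one (measurable_fst (measurableSet_singleton x))]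
  rfl

end MDP

/-! ### The noise of the updates -/

namespace ReplayProcess

variable {Ω S A : Type*} [DecidableEq S] [DecidableEq A]

theorem Q_succ (D : ReplayProcess Ω S A) (K M : ℕ) (γ : ℝ) (Q₀ : S → A → ℝ) (t : ℕ) (ω : Ω)
    (s : S) (a : A) : D.Q K M γ Q₀ (t + 1) ω s a =
      (1 - D.alpha K M t ω s a) * D.Q K M γ Q₀ t ω s a
        + D.alpha K M t ω s a *
          (D.reward (D.entry K M t ω) ω
            + γ * ⨆ a', D.Q K M γ Q₀ t ω (D.state (D.entry K M t ω + 1) ω) a') := rfl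

/-- The learning rate, set to `0` when it or the table is too large. -/
noncomputable def cutRate (D : ReplayProcess Ω S A) (K M : ℕ) (γ : ℝ) (Q₀ : S → A → ℝ) (B : ℕ)
    (s : S) (a : A) (t : ℕ) (ω : Ω) : ℝ :=
  open Classical in
  if |D.rate t ω s a| ≤ 1 ∧ ∀ s' a', |D.Q K M γ Q₀ t ω s' a'| ≤ B then D.rate t ω s a else 0

theorem abs_cutRate_le_one (D : ReplayProcess Ω S A) (K M : ℕ) (γ : ℝ) (Q₀ : S → A → ℝ) (B : ℕ)
    (s : S) (a : A) (t : ℕ) (ω : Ω) : |D.cutRate K M γ Q₀ B s a t ω| ≤ 1 := by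
  unfold cutRate
  split_ifs with h
  · exact h.1
  · simp

theorem abs_cutRate_le (D : ReplayProcess Ω S A) (K M : ℕ) (γ : ℝ) (Q₀ : S → A → ℝ) (B : ℕ)
    (s : S) (a : A) (t : ℕ) (ω : Ω) : |D.cutRate K M γ Q₀ B s a t ω| ≤ |D.rate t ω s a| := by
  unfold cutRate
  split_ifs with h
  · exact le_rfl
  · simp

/-- When the table exceeds `B` the cut rate is `0`, so no bound on the table is needed. -/
theorem abs_cutRate_mul_value_le [Finite A] (D : ReplayProcess Ω S A) (K M : ℕ) (γ : ℝ)
    (Q₀ : S → A → ℝ) (B : ℕ) (s : S) (a : A) (t : ℕ) (ω : Ω) (x : S) :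
    |D.cutRate K M γ Q₀ B s a t ω * ⨆ b, D.Q K M γ Q₀ t ω x b| ≤
      |D.cutRate K M γ Q₀ B s a t ω| * B := by
  rw [abs_mul]
  unfold cutRate
  split_ifs with h
  · exact mul_le_mul_of_nonneg_left (abs_ciSup_le (Nat.cast_nonneg B) fun b => h.2 x b)
      (abs_nonneg _)
  · simp

variable [MeasurableSpace S] [Fintype S]

/-- The noise in the update of `(s, a)` in iteration `t`. -/
noncomputable def noise (D : ReplayProcess Ω S A) (𝓜 : MDP S A) (K M : ℕ) (γ : ℝ)
    (Q₀ : S → A → ℝ) (B : ℕ) (s : S) (a : A) (t : ℕ) (ω : Ω) : ℝ :=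
  D.cutRate K M γ Q₀ B s a t ω * D.innovation 𝓜 K M s a 𝓜.clampedReward t ω +
    ∑ x, γ * (D.cutRate K M γ Q₀ B s a t ω * ⨆ b, D.Q K M γ Q₀ t ω x b) *
      D.innovation 𝓜 K M s a (nextState x) t ω

variable [Fintype A]

theorem abs_noise_le (D : ReplayProcess Ω S A) (𝓜 : MDP S A) (K M : ℕ) (γ : ℝ)
    (Q₀ : S → A → ℝ) (B : ℕ) (s : S) (a : A) (t : ℕ) (ω : Ω) :
    |D.noise 𝓜 K M γ Q₀ B s a t ω| ≤
      |D.cutRate K M γ Q₀ B s a t ω| * D.visit s a (D.entry K M t ω) ω *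
        (2 * |𝓜.Rmax| + Fintype.card S * (|γ| * B * 2)) := by
  set v := D.visit s a (D.entry K M t ω) ω
  set ρ := D.cutRate K M γ Q₀ B s a t ω with hρ
  have h1 : |ρ * D.innovation 𝓜 K M s a 𝓜.clampedReward t ω| ≤ |ρ| * (v * (2 * |𝓜.Rmax|)) := by
    rw [abs_mul]
    exact mul_le_mul_of_nonneg_left (D.abs_innovation_le 𝓜 K M s a 𝓜.abs_clampedReward_le t ω)
      (abs_nonneg _)
  have h2 : ∀ x ∈ Finset.univ, |γ * (ρ * ⨆ b, D.Q K M γ Q₀ t ω x b) *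
      D.innovation 𝓜 K M s a (nextState x) t ω| ≤ |γ| * (|ρ| * B) * (v * (2 * 1)) := by
    intro x _
    rw [abs_mul, abs_mul]
    exact mul_le_mul (mul_le_mul_of_nonneg_left
      (D.abs_cutRate_mul_value_le K M γ Q₀ B s a t ω x) (abs_nonneg _))
      (D.abs_innovation_le 𝓜 K M s a (abs_nextState_le x) t ω) (abs_nonneg _) (by positivity)
  have h3 := (Finset.abs_sum_le_sum_abs _ _).trans (Finset.sum_le_sum h2)
  rw [Finset.sum_const, Finset.card_univ, nsmul_eq_mul] at h3
  calc |D.noise 𝓜 K M γ Q₀ B s a t ω| ≤ _ := abs_add_le _ _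
    _ ≤ _ := add_le_add h1 h3
    _ = _ := by ring

variable [MeasurableSpace A] [MeasurableSingletonClass S] [MeasurableSingletonClass A]
  {mΩ : MeasurableSpace Ω}
  {D : ReplayProcess Ω S A} {𝓜 : MDP S A} {K M : ℕ} {μ : Measure Ω} {ℱ : Filtration ℕ mΩ}

theorem IsRun.measurable_Q (hD : D.IsRun 𝓜 K M μ ℱ) (hI : D.IndexInBuffer K M) (γ : ℝ)
    (Q₀ : S → A → ℝ) (t : ℕ) : ∀ s a, Measurable[ℱ t] (fun ω => D.Q K M γ Q₀ t ω s a) := by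
  induction t with
  | zero => exact fun s a => measurable_const
  | succ t ih =>
    intro s a
    have hle : ℱ t ≤ ℱ (t + 1) := ℱ.mono t.le_succ
    have hQ : ∀ s a, Measurable[ℱ (t + 1)] (fun ω => D.Q K M γ Q₀ t ω s a) := fun s a =>
      (ih s a).mono hle le_rfl
    have hrate : Measurable[ℱ (t + 1)] (fun ω => D.rate t ω s a) :=
      (hD.measurable_rate t s a).mono hle le_rfl
    -- Expanding the value of the next state in indicators exhibits the update with a fixed position
    -- `j` as a measurable function.
    have h := hD.measurable_comp_entry hI t
      (X := fun j ω => (1 - D.visit s a j ω * D.rate t ω s a) * D.Q K M γ Q₀ t ω s a +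
        D.visit s a j ω * D.rate t ω s a * ((D.outcome j ω).2 +
          γ * ∑ x, (⨆ b, D.Q K M γ Q₀ t ω x b) * nextState x (D.outcome j ω))) fun j hj => ?_
    · simp only [Q_succ, alpha_eq]
      simp only [sum_mul_nextState (fun x => ⨆ b, D.Q K M γ Q₀ t _ x b)] at h
      exact h
    · obtain ⟨h1, h2, h3⟩ := hD.measurable_buffer (t + 1) j hj
      have hv := (measurable_visit h1 h2 s a).mul hrate
      refine ((hv.const_sub 1).mul (hQ s a)).add (hv.mul
        ((measurable_snd.comp h3).add (Measurable.const_mul ?_ γ)))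
      exact Finset.measurable_sum _ fun x _ =>
        (Measurable.iSup fun b => hQ x b).mul ((measurable_nextState x).comp h3)

theorem IsRun.measurable_cutRate (hD : D.IsRun 𝓜 K M μ ℱ) (hI : D.IndexInBuffer K M) (γ : ℝ)
    (Q₀ : S → A → ℝ) (B : ℕ) (s : S) (a : A) (t : ℕ) :
    Measurable[ℱ t] (D.cutRate K M γ Q₀ B s a t) := by
  refine Measurable.ite (MeasurableSet.inter ?_ ?_) (hD.measurable_rate t s a) measurable_const
  · have h1 : Measurable[ℱ t] fun ω => |D.rate t ω s a| :=
      continuous_abs.measurable.comp (hD.measurable_rate t s a)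
    exact h1 measurableSet_Iic
  · have h1 : ∀ s' a', MeasurableSet[ℱ t] {ω | |D.Q K M γ Q₀ t ω s' a'| ≤ B} := fun s' a' => by
      have h2 : Measurable[ℱ t] fun ω => |D.Q K M γ Q₀ t ω s' a'| :=
        continuous_abs.measurable.comp (hD.measurable_Q hI γ Q₀ t s' a')
      exact h2 measurableSet_Iic
    have h2 : {ω | ∀ s' a', |D.Q K M γ Q₀ t ω s' a'| ≤ B} =
        ⋂ s', ⋂ a', {ω | |D.Q K M γ Q₀ t ω s' a'| ≤ B} := by ext; simp
    change MeasurableSet[ℱ t] {ω | ∀ s' a', |D.Q K M γ Q₀ t ω s' a'| ≤ B}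
    rw [h2]
    exact @MeasurableSet.iInter _ _ (ℱ t) _ _ fun s' =>
      @MeasurableSet.iInter _ _ (ℱ t) _ _ fun a' => h1 s' a'

theorem IsRun.measurable_coefficient (hD : D.IsRun 𝓜 K M μ ℱ) (hI : D.IndexInBuffer K M) (γ : ℝ)
    (Q₀ : S → A → ℝ) (B : ℕ) (s : S) (a : A) (t : ℕ) (x : S) :
    Measurable[ℱ t] fun ω =>
      γ * (D.cutRate K M γ Q₀ B s a t ω * ⨆ b, D.Q K M γ Q₀ t ω x b) :=
  ((hD.measurable_cutRate hI γ Q₀ B s a t).mul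
    (Measurable.iSup fun b => hD.measurable_Q hI γ Q₀ t x b)).const_mul γ

variable [IsProbabilityMeasure μ]

/-- The expansion in next-state indicators confines the table to coefficients that are known at `ℱ
t` and bounded by the cutoff. They multiply innovations of fixed functions, each of conditional mean
zero. -/
theorem IsRun.condExp_noise (hD : D.IsRun 𝓜 K M μ ℱ) (hI : D.IndexInBuffer K M) (γ : ℝ)
    (Q₀ : S → A → ℝ) (B : ℕ) (s : S) (a : A) (t : ℕ) :
    μ[D.noise 𝓜 K M γ Q₀ B s a t | ℱ t] =ᵐ[μ] 0 := by
  have hi0 := hD.integrable_innovation hI s a 𝓜.measurable_clampedReward 𝓜.abs_clampedReward_le t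
  have hix := fun x => hD.integrable_innovation hI s a (measurable_nextState x)
    (abs_nextState_le x) t
  have hρ := hD.measurable_cutRate hI γ Q₀ B s a t
  have hκ := hD.measurable_coefficient hI γ Q₀ B s a t
  have hρb := D.abs_cutRate_le_one K M γ Q₀ B s a t
  have hκb : ∀ x ω, |γ * (D.cutRate K M γ Q₀ B s a t ω * ⨆ b, D.Q K M γ Q₀ t ω x b)| ≤
      |γ| * B := fun x ω => by
    rw [abs_mul]
    refine mul_le_mul_of_nonneg_left ?_ (abs_nonneg _)
    exact (D.abs_cutRate_mul_value_le K M γ Q₀ B s a t ω x).trans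
      (mul_le_of_le_one_left (Nat.cast_nonneg B) (hρb ω))
  have h0 := condExp_mul_ae_eq_zero (ℱ.le t) hρ hρb hi0
    (hD.condExp_innovation hI s a 𝓜.measurable_clampedReward 𝓜.abs_clampedReward_le t)
  have hx := fun x => condExp_mul_ae_eq_zero (ℱ.le t) (hκ x) (hκb x) (hix x)
    (hD.condExp_innovation hI s a (measurable_nextState x) (abs_nextState_le x) t)
  have hint0 : Integrable (fun ω => D.cutRate K M γ Q₀ B s a t ω *
      D.innovation 𝓜 K M s a 𝓜.clampedReward t ω) μ :=
    hi0.bdd_mul (hρ.mono (ℱ.le t) le_rfl).aestronglyMeasurable (ae_of_all _ hρb)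
  have hintx : ∀ x ∈ Finset.univ, Integrable (fun ω =>
      γ * (D.cutRate K M γ Q₀ B s a t ω * ⨆ b, D.Q K M γ Q₀ t ω x b) *
        D.innovation 𝓜 K M s a (nextState x) t ω) μ := fun x _ =>
    (hix x).bdd_mul ((hκ x).mono (ℱ.le t) le_rfl).aestronglyMeasurable (ae_of_all _ (hκb x))
  have hsum := condExp_finsetSum hintx (ℱ t)
  have hdecomp : D.noise 𝓜 K M γ Q₀ B s a t =
      (fun ω => D.cutRate K M γ Q₀ B s a t ω * D.innovation 𝓜 K M s a 𝓜.clampedReward t ω) +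
      ∑ x, fun ω => γ * (D.cutRate K M γ Q₀ B s a t ω * ⨆ b, D.Q K M γ Q₀ t ω x b) *
        D.innovation 𝓜 K M s a (nextState x) t ω := by
    ext ω; simp [noise]
  rw [hdecomp]
  filter_upwards [condExp_add hint0 (integrable_finsetSum' _ hintx) (ℱ t), h0, hsum,
    ae_all_iff.2 hx] with ω h1 h2 h3 h4
  rw [h1, Pi.add_apply, h2, h3, Finset.sum_apply, Finset.sum_eq_zero fun x _ => h4 x]
  simp

/-- The visit indicator times the cut rate is at most `|α_t|` in absolute value, so square
summability passes from the learning rates to the noise. -/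
theorem IsRun.ae_exists_tendsto_sum_noise (hD : D.IsRun 𝓜 K M μ ℱ) (hI : D.IndexInBuffer K M)
    (γ : ℝ) (Q₀ : S → A → ℝ) (B : ℕ) (s : S) (a : A) :
    ∀ᵐ ω ∂μ, Summable (fun t => D.alpha K M t ω s a ^ 2) →
      ∃ L, Tendsto (fun n => ∑ t ∈ Finset.range n, D.noise 𝓜 K M γ Q₀ B s a t ω) atTop (𝓝 L) := by
  set C := 2 * |𝓜.Rmax| + Fintype.card S * (|γ| * B * 2) with hC
  have hC0 : 0 ≤ C := by positivity
  have hle : ∀ t, ℱ t ≤ ℱ (t + 1) := fun t => ℱ.mono t.le_succ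
  have hmain := ae_exists_tendsto_sum_of_summable_sq (μ := μ) (ℱ := ℱ) (C := C)
    (ξ := D.noise 𝓜 K M γ Q₀ B s a)
    (fun t => (((hD.measurable_cutRate hI γ Q₀ B s a t).mono (hle t) le_rfl).mul
        (hD.measurable_innovation hI s a 𝓜.measurable_clampedReward t)).add
      (Finset.measurable_sum _ fun x _ =>
        ((hD.measurable_coefficient hI γ Q₀ B s a t x).mono (hle t) le_rfl).mul
          (hD.measurable_innovation hI s a (measurable_nextState x) t)))
    (fun t ω => (D.abs_noise_le 𝓜 K M γ Q₀ B s a t ω).trans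
      (mul_le_of_le_one_left hC0 (mul_le_one₀ (D.abs_cutRate_le_one K M γ Q₀ B s a t ω)
        (D.visit_nonneg _ _ _ _) (D.visit_le_one _ _ _ _))))
    (fun t => hD.condExp_noise hI γ Q₀ B s a t)
  filter_upwards [hmain] with ω hω hs
  refine hω (Summable.of_nonneg_of_le (fun _ => sq_nonneg _) (fun t => ?_) (hs.mul_right (C ^ 2)))
  rw [← mul_pow]
  refine sq_le_sq.2 ((D.abs_noise_le 𝓜 K M γ Q₀ B s a t ω).trans ?_)
  rw [abs_mul, abs_of_nonneg hC0, alpha_eq, abs_mul, abs_of_nonneg (D.visit_nonneg _ _ _ _)]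
  refine mul_le_mul_of_nonneg_right ?_ hC0
  rw [mul_comm]
  exact mul_le_mul_of_nonneg_left (D.abs_cutRate_le K M γ Q₀ B s a t ω) (D.visit_nonneg _ _ _ _)

end ReplayProcess

/-! ### Convergence along a single path -/

namespace ReplayProcess

variable {Ω S A : Type*} [DecidableEq S] [DecidableEq A] [Fintype S]

/-- Once the learning rates are at most `1`, the table stays bounded. -/
theorem exists_eventually_abs_Q_le [Fintype A] (D : ReplayProcess Ω S A) {K M : ℕ} {γ r : ℝ} (hγ0 : 0 < γ)
    (hγ1 : γ < 1) (Q₀ : S → A → ℝ) {ω : Ω} (hr : ∀ j, |D.reward j ω| ≤ r)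
    (h0 : ∀ s a t, 0 ≤ D.alpha K M t ω s a)
    (h1 : ∀ᶠ t in atTop, ∀ s a, D.alpha K M t ω s a ≤ 1) :
    ∃ B : ℕ, ∀ᶠ t in atTop, ∀ s a, |D.Q K M γ Q₀ t ω s a| ≤ B := by
  obtain ⟨N, hN⟩ := eventually_atTop.1 h1
  -- The first bound covers the table at time `N`; the second gives `r + γ * B ≤ B`, so that `[-B,
  -- B]` is preserved by the updates.
  obtain ⟨B, hB⟩ := exists_nat_ge (max (∑ s, ∑ a, |D.Q K M γ Q₀ N ω s a|) (r / (1 - γ)))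
  have hBr : r ≤ (1 - γ) * B := by
    have := (le_max_right _ _).trans hB
    rw [div_le_iff₀ (by linarith)] at this
    linarith
  refine ⟨B, eventually_atTop.2 ⟨N, fun t ht => ?_⟩⟩
  induction t, ht using Nat.le_induction with
  | base =>
    intro s a
    refine le_trans ?_ ((le_max_left _ _).trans hB)
    refine (Finset.single_le_sum (f := fun a => |D.Q K M γ Q₀ N ω s a|)
      (fun _ _ => abs_nonneg _) (Finset.mem_univ a)).trans ?_
    exact Finset.single_le_sum (f := fun s => ∑ a, |D.Q K M γ Q₀ N ω s a|)
      (fun _ _ => Finset.sum_nonneg fun _ _ => abs_nonneg _) (Finset.mem_univ s)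
  | succ t ht ih =>
    intro s a
    have hα0 := h0 s a t
    have hα1 := hN t ht s a
    rw [Q_succ]
    set α := D.alpha K M t ω s a
    set j := D.entry K M t ω
    have h2 : |⨆ a', D.Q K M γ Q₀ t ω (D.state (j + 1) ω) a'| ≤ B :=
      abs_ciSup_le (Nat.cast_nonneg B) fun b => ih _ b
    have h3 : |D.reward j ω + γ * ⨆ a', D.Q K M γ Q₀ t ω (D.state (j + 1) ω) a'| ≤ B := by
      refine (abs_add_le _ _).trans ?_
      rw [abs_mul, abs_of_pos hγ0]
      have h4 := hr j
      have h5 := mul_le_mul_of_nonneg_left h2 hγ0.le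
      linarith
    refine (abs_add_le _ _).trans ?_
    rw [abs_mul, abs_mul, abs_of_nonneg hα0, abs_of_nonneg (show 0 ≤ 1 - α by linarith)]
    have h4 := mul_le_mul_of_nonneg_left h3 hα0
    have h5 := mul_le_mul_of_nonneg_left (ih s a) (show 0 ≤ 1 - α by linarith)
    linarith

variable [MeasurableSpace S]

/-- The conditional mean of the update target of `(s, a)`. -/
noncomputable def meanTarget (D : ReplayProcess Ω S A) (𝓜 : MDP S A) (K M : ℕ) (γ : ℝ)
    (Q₀ : S → A → ℝ) (s : S) (a : A) (t : ℕ) (ω : Ω) : ℝ :=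
  D.condMean 𝓜 K M s a 𝓜.clampedReward t ω +
    γ * ∑ x, (⨆ b, D.Q K M γ Q₀ t ω x b) * D.condMean 𝓜 K M s a (nextState x) t ω

/-- The update is a noisy relaxation towards the conditional mean of its target. -/
theorem Q_succ_eq_of_abs_le (D : ReplayProcess Ω S A) (𝓜 : MDP S A) {K M : ℕ} {γ : ℝ}
    (Q₀ : S → A → ℝ) {B t : ℕ} {ω : Ω} {s : S} {a : A} (hr : ∀ j, |D.reward j ω| ≤ 𝓜.Rmax)
    (h0 : 0 ≤ D.alpha K M t ω s a) (h1 : D.alpha K M t ω s a ≤ 1)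
    (hB : ∀ s a, |D.Q K M γ Q₀ t ω s a| ≤ B) :
    D.Q K M γ Q₀ (t + 1) ω s a =
      (1 - D.alpha K M t ω s a) * D.Q K M γ Q₀ t ω s a +
        D.alpha K M t ω s a * D.meanTarget 𝓜 K M γ Q₀ s a t ω +
        D.noise 𝓜 K M γ Q₀ B s a t ω := by
  set j := D.entry K M t ω with hj
  have hαv := D.alpha_eq K M t ω s a
  -- At a visit the rate equals `α_t ≤ 1`, so the cutoff is inactive. Without a visit the rate may
  -- be large, but the indicator removes it.
  have hcut : D.cutRate K M γ Q₀ B s a t ω * D.visit s a j ω = D.alpha K M t ω s a := by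
    rw [hαv, mul_comm]
    by_cases h : D.state j ω = s ∧ D.action j ω = a
    · have hv : D.visit s a j ω = 1 := if_pos h
      rw [← hj, hv, one_mul] at hαv
      have habs : |D.rate t ω s a| ≤ 1 := by rw [← hαv, abs_of_nonneg h0]; exact h1
      rw [cutRate, if_pos ⟨habs, hB⟩]
    · have hv : D.visit s a j ω = 0 := if_neg h
      rw [← hj, hv, zero_mul, zero_mul]
  have hreward : D.reward j ω = 𝓜.clampedReward (D.outcome j ω) :=
    (𝓜.clampedReward_eq (y := D.outcome j ω) (hr j)).symm
  have hvalue := sum_mul_nextState (fun x => ⨆ b, D.Q K M γ Q₀ t ω x b) (D.outcome j ω)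
  have hnoise : D.noise 𝓜 K M γ Q₀ B s a t ω = D.alpha K M t ω s a *
      ((𝓜.clampedReward (D.outcome j ω) - D.condMean 𝓜 K M s a 𝓜.clampedReward t ω) +
        γ * ∑ x, (⨆ b, D.Q K M γ Q₀ t ω x b) * (nextState x (D.outcome j ω) -
          D.condMean 𝓜 K M s a (nextState x) t ω)) := by
    rw [noise, ← hcut, mul_add, Finset.mul_sum, Finset.mul_sum]
    simp only [innovation, ← hj]
    congr 1
    · ring
    · exact Finset.sum_congr rfl fun x _ => by ring
  rw [Q_succ, hnoise, meanTarget, ← hj, hreward]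
  simp only [mul_sub, Finset.sum_sub_distrib]
  rw [hvalue]
  simp only [outcome]
  ring

variable [Fintype A]

/-- Both expressions use the same table and differ only in mean reward and transition weights. These
converge, and boundedness of the table suffices to make the difference vanish. -/
theorem tendsto_meanTarget_sub_bellman [MeasurableSingletonClass S] (D : ReplayProcess Ω S A)
    (𝓜 : MDP S A) {K M : ℕ} {γ : ℝ} (Q₀ : S → A → ℝ) {B : ℕ} {ω : Ω} {s : S} {a : A}
    (hB : ∀ᶠ t in atTop, ∀ s a, |D.Q K M γ Q₀ t ω s a| ≤ B)
    (hR : Tendsto (fun t => D.condMean 𝓜 K M s a 𝓜.clampedReward t ω) atTop (𝓝 (𝓜.R s a)))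
    (hP : ∀ x, Tendsto (fun t => D.condMean 𝓜 K M s a (nextState x) t ω) atTop
      (𝓝 (𝓜.P s a x))) :
    Tendsto (fun t => D.meanTarget 𝓜 K M γ Q₀ s a t ω -
      𝓜.bellman γ (D.Q K M γ Q₀ t ω) s a) atTop (𝓝 0) := by
  have h1 : ∀ x, Tendsto (fun t => (⨆ b, D.Q K M γ Q₀ t ω x b) *
      (D.condMean 𝓜 K M s a (nextState x) t ω - 𝓜.P s a x)) atTop (𝓝 0) := fun x => by
    refine bdd_le_mul_tendsto_zero' (B : ℝ) ?_ (by simpa using (hP x).sub_const (𝓜.P s a x))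
    filter_upwards [hB] with t ht using abs_ciSup_le (Nat.cast_nonneg B) fun b => ht x b
  have h2 := (hR.sub_const (𝓜.R s a)).add
    ((tendsto_finsetSum Finset.univ fun x _ => h1 x).const_mul γ)
  simp only [sub_self, Finset.sum_const_zero, mul_zero, add_zero] at h2
  refine h2.congr fun t => ?_
  simp only [meanTarget, MDP.bellman, mul_sub, Finset.sum_sub_distrib]
  simp only [mul_comm (𝓜.P s a _)]
  ring

/-- Convergence along a path on which the noise is summable, the buffer means are consistent and
the rewards are bounded. -/
theorem tendsto_Q [MeasurableSingletonClass S] (D : ReplayProcess Ω S A) (𝓜 : MDP S A) {K M : ℕ}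
    {γ : ℝ} (hγ0 : 0 < γ) (hγ1 : γ < 1) (Q₀ : S → A → ℝ) {ω : Ω}
    (hr : ∀ j, |D.reward j ω| ≤ 𝓜.Rmax)
    (h0 : ∀ s a t, 0 ≤ D.alpha K M t ω s a)
    (hsum : ∀ s a,
      Tendsto (fun n : ℕ => ∑ t ∈ Finset.range n, D.alpha K M t ω s a) atTop atTop)
    (hsq : ∀ s a, Summable (fun t : ℕ => D.alpha K M t ω s a ^ 2))
    (hR : ∀ s a, Tendsto (fun t => D.condMean 𝓜 K M s a 𝓜.clampedReward t ω) atTop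
      (𝓝 (𝓜.R s a)))
    (hP : ∀ s a x, Tendsto (fun t => D.condMean 𝓜 K M s a (nextState x) t ω) atTop
      (𝓝 (𝓜.P s a x)))
    (hnoise : ∀ (B : ℕ) s a, ∃ L, Tendsto
      (fun n => ∑ t ∈ Finset.range n, D.noise 𝓜 K M γ Q₀ B s a t ω) atTop (𝓝 L)) (s : S) (a : A) :
    Tendsto (fun t => D.Q K M γ Q₀ t ω s a) atTop (𝓝 (𝓜.optimalQ γ s a)) := by
  -- Square summability forces the rates to `0`.
  have h1 : ∀ᶠ t in atTop, ∀ s a, D.alpha K M t ω s a ≤ 1 := by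
    refine eventually_all.2 fun s => eventually_all.2 fun a => ?_
    filter_upwards [(hsq s a).tendsto_atTop_zero.eventually_lt_const one_pos] with t ht
    nlinarith [h0 s a t]
  obtain ⟨B, hB⟩ := D.exists_eventually_abs_Q_le hγ0 hγ1 Q₀ hr h0 h1
  set q := 𝓜.optimalQ γ with hq
  have hfix : 𝓜.bellman γ q = q := 𝓜.bellman_optimalQ hγ0.le hγ1
  -- One round of contraction: an asymptotic error bound `d` improves to `γ * d`.
  have step : ∀ d : ℝ, 0 ≤ d →
      (∀ ε > 0, ∀ᶠ t in atTop, ∀ s a, |D.Q K M γ Q₀ t ω s a - q s a| ≤ d + ε) →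
      ∀ ε > 0, ∀ᶠ t in atTop, ∀ s a, |D.Q K M γ Q₀ t ω s a - q s a| ≤ γ * d + ε := by
    intro d hd hclose ε hε
    refine eventually_all.2 fun s => eventually_all.2 fun a => ?_
    have hbias := (D.tendsto_meanTarget_sub_bellman 𝓜 Q₀ hB (hR s a) (hP s a)).abs
    rw [abs_zero] at hbias
    have hF : ∀ᶠ t in atTop,
        |D.meanTarget 𝓜 K M γ Q₀ s a t ω - q s a| ≤ γ * d + ε / 2 := by
      -- The budget is `γ * (d + ε / 4) + ε / 4 ≤ γ * d + ε / 2`; the other `ε / 2` is spent in the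
      -- relaxation.
      filter_upwards [hclose (ε / 4) (by linarith),
        hbias.eventually_lt_const (show 0 < ε / 4 by linarith)] with t h2 h3
      have h4 := 𝓜.abs_bellman_sub_le hγ0.le (by positivity) h2 s a
      rw [hfix] at h4
      have h5 := abs_add_le (D.meanTarget 𝓜 K M γ Q₀ s a t ω -
        𝓜.bellman γ (D.Q K M γ Q₀ t ω) s a) (𝓜.bellman γ (D.Q K M γ Q₀ t ω) s a - q s a)
      rw [sub_add_sub_cancel] at h5
      nlinarith
    have hmain := eventually_abs_le_add_of_noisy_relaxation
      (x := fun t => D.Q K M γ Q₀ t ω s a - q s a) (h0 s a) (h1.mono fun t h => h s a)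
      (hsum s a) (hnoise B s a) hF ?_ (half_pos hε)
    · filter_upwards [hmain] with t ht
      linarith
    · filter_upwards [h1, hB] with t h2 h3
      rw [D.Q_succ_eq_of_abs_le 𝓜 Q₀ hr (h0 s a t) (h2 s a) h3]
      ring
  set d₀ : ℝ := B + ∑ s, ∑ a, |q s a| with hd₀
  have hd₀0 : 0 ≤ d₀ := by positivity
  have hpow : ∀ n : ℕ, ∀ ε > 0,
      ∀ᶠ t in atTop, ∀ s a, |D.Q K M γ Q₀ t ω s a - q s a| ≤ γ ^ n * d₀ + ε := by
    intro n
    induction n with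
    | zero =>
      intro ε hε
      filter_upwards [hB] with t ht s a
      have h2 := abs_sub (D.Q K M γ Q₀ t ω s a) (q s a)
      have h3 := Finset.single_le_sum (f := fun a => |q s a|)
        (fun _ _ => abs_nonneg _) (Finset.mem_univ a)
      have h4 := Finset.single_le_sum (f := fun s => ∑ a, |q s a|)
        (fun _ _ => Finset.sum_nonneg fun _ _ => abs_nonneg _) (Finset.mem_univ s)
      have h5 := ht s a
      rw [pow_zero, one_mul, hd₀]
      linarith
    | succ n ih =>
      have h2 := step (γ ^ n * d₀) (by positivity) ih
      rwa [← mul_assoc, ← pow_succ'] at h2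
  refine Metric.tendsto_nhds.2 fun ε hε => ?_
  have hlim : Tendsto (fun n : ℕ => γ ^ n * d₀) atTop (𝓝 0) := by
    simpa using (tendsto_pow_atTop_nhds_zero_of_lt_one hγ0.le hγ1).mul_const d₀
  obtain ⟨n, hn⟩ := (hlim.eventually_lt_const (half_pos hε)).exists
  filter_upwards [hpow n (ε / 4) (by linarith)] with t ht
  have h2 := ht s a
  rw [Real.dist_eq]
  linarith

end ReplayProcess

/-! ### Removing positions outside the buffer, and conclusion -/

namespace ReplayProcess

section Buffer

variable {Ω S A : Type*}

/-- The process in which a position outside the buffer is replaced by position `0`. -/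
def withIndexInBuffer (D : ReplayProcess Ω S A) (K M : ℕ) : ReplayProcess Ω S A :=
  { D with
    index := fun t ω => if D.index t ω < onlineCount K M t then D.index t ω else 0 }

theorem indexInBuffer_withIndexInBuffer (D : ReplayProcess Ω S A) {K : ℕ} (M : ℕ) (hK : 0 < K) :
    (D.withIndexInBuffer K M).IndexInBuffer K M := by
  intro t ω ht
  simp only [withIndexInBuffer]
  split_ifs with h
  · exact h
  -- Position `0` is always available, since iteration `0` is online.
  · exact onlineCount_pos hK ht

variable [MeasurableSpace S] [MeasurableSpace A] {mΩ : MeasurableSpace Ω}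
  {D : ReplayProcess Ω S A} {𝓜 : MDP S A} {K M : ℕ} {μ : Measure Ω} {ℱ : Filtration ℕ mΩ}
  [IsProbabilityMeasure μ]

/-- The `c` positions in the buffer have probability `1 / c` each, which leaves no mass for any
other. -/
theorem IsRun.ae_index_lt (hD : D.IsRun 𝓜 K M μ ℱ) (hK : 0 < K) {t : ℕ}
    (ht : ¬ IsOnline K M t) : ∀ᵐ ω ∂μ, D.index t ω < onlineCount K M t := by
  set c := onlineCount K M t with hc
  have hc0 : (c : ℝ) ≠ 0 := by exact_mod_cast (onlineCount_pos hK ht).ne'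
  have hJ : Measurable (D.index t) := (hD.measurable_index t ht).mono (ℱ.le _) le_rfl
  have hm : ∀ j, MeasurableSet (D.index t ⁻¹' {j}) := fun j => hJ (measurableSet_singleton j)
  have hprob : ∀ j ∈ Finset.range c, μ.real (D.index t ⁻¹' {j}) = 1 / (c : ℝ) := by
    intro j hj
    have h1 : ∫ ω, (μ⟦D.index t ⁻¹' {j} | ℱ t⟧) ω ∂μ =
        ∫ ω, (D.index t ⁻¹' {j}).indicator (1 : Ω → ℝ) ω ∂μ := integral_condExp (ℱ.le t)
    rw [integral_indicator_one (hm j),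
      integral_congr_ae (hD.replay_law t ht j (Finset.mem_range.1 hj))] at h1
    simpa using h1.symm
  have hset : D.index t ⁻¹' Set.Iio c = ⋃ j ∈ Finset.range c, D.index t ⁻¹' {j} := by
    ext ω; simp
  have htotal : μ.real (D.index t ⁻¹' Set.Iio c) = 1 := by
    rw [hset, measureReal_biUnion_finset ?_ fun j _ => hm j, Finset.sum_congr rfl hprob]
    · simp [hc0]
    · intro i _ j _ hij
      exact Set.disjoint_left.2 fun ω h1 h2 => hij (h1.symm.trans h2)
  have h2 : μ (D.index t ⁻¹' Set.Iio c) = 1 := by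
    rw [← ENNReal.toReal_eq_one_iff]; exact htotal
  exact (mem_ae_iff_prob_eq_one (hJ measurableSet_Iio)).2 h2

/-- Each drawn position changes only on a null set, so its conditional law is unaffected. -/
theorem IsRun.withIndexInBuffer (hD : D.IsRun 𝓜 K M μ ℱ) (hK : 0 < K) :
    (D.withIndexInBuffer K M).IsRun 𝓜 K M μ ℱ where
  measurable_state := hD.measurable_state
  measurable_action := hD.measurable_action
  measurable_reward := hD.measurable_reward
  measurable_rate := hD.measurable_rate
  online_law := hD.online_law
  measurable_index t ht := Measurable.ite
    (hD.measurable_index t ht measurableSet_Iio) (hD.measurable_index t ht) measurable_const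
  replay_law t ht j hj := by
    refine EventuallyEq.trans (condExp_congr_ae ?_) (hD.replay_law t ht j hj)
    filter_upwards [hD.ae_index_lt hK ht] with ω hω
    exact congrArg (({j} : Set ℕ).indicator fun _ => (1 : ℝ)) (if_pos hω)

theorem IsRun.ae_entry_eq (hD : D.IsRun 𝓜 K M μ ℱ) (hK : 0 < K) :
    ∀ᵐ ω ∂μ, ∀ t, (D.withIndexInBuffer K M).entry K M t ω = D.entry K M t ω := by
  refine ae_all_iff.2 fun t => ?_
  by_cases ht : IsOnline K M t
  · exact ae_of_all _ fun ω => by rw [entry_of_online _ ht, entry_of_online _ ht]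
  · filter_upwards [hD.ae_index_lt hK ht] with ω hω
    rw [entry_of_not_online _ ht, entry_of_not_online _ ht]
    exact if_pos hω

end Buffer

variable {Ω S A : Type*} [DecidableEq S] [DecidableEq A]

theorem alpha_withIndexInBuffer {D : ReplayProcess Ω S A} {K M : ℕ} {ω : Ω}
    (h : ∀ t, (D.withIndexInBuffer K M).entry K M t ω = D.entry K M t ω) (t : ℕ) (s : S) (a : A) :
    (D.withIndexInBuffer K M).alpha K M t ω s a = D.alpha K M t ω s a := by
  simp only [alpha, h]; rfl

theorem Q_withIndexInBuffer {D : ReplayProcess Ω S A} {K M : ℕ} {ω : Ω}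
    (h : ∀ t, (D.withIndexInBuffer K M).entry K M t ω = D.entry K M t ω) (γ : ℝ)
    (Q₀ : S → A → ℝ) (t : ℕ) :
    (D.withIndexInBuffer K M).Q K M γ Q₀ t ω = D.Q K M γ Q₀ t ω := by
  induction t with
  | zero => rfl
  | succ t ih =>
    ext s a
    rw [Q_succ, Q_succ, ih, alpha_withIndexInBuffer h, h]
    rfl

variable [Fintype S] [Fintype A] [MeasurableSpace S] [MeasurableSingletonClass S]
  [MeasurableSpace A] [MeasurableSingletonClass A] {mΩ : MeasurableSpace Ω}
  {D : ReplayProcess Ω S A} {𝓜 : MDP S A} {K M : ℕ} {μ : Measure Ω} {ℱ : Filtration ℕ mΩ}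
  [IsProbabilityMeasure μ]

theorem IsRun.ae_tendsto_Q (hD : D.IsRun 𝓜 K M μ ℱ) (hI : D.IndexInBuffer K M) (hK : 0 < K)
    {γ : ℝ} (hγ0 : 0 < γ) (hγ1 : γ < 1) (Q₀ : S → A → ℝ)
    (hvisit : ∀ᵐ ω ∂μ, ∀ s a, {i : ℕ | D.state i ω = s ∧ D.action i ω = a}.Infinite)
    (hα_nonneg : ∀ᵐ ω ∂μ, ∀ s a t, 0 ≤ D.alpha K M t ω s a)
    (hα_sum : ∀ᵐ ω ∂μ, ∀ s a,
      Tendsto (fun n : ℕ => ∑ t ∈ Finset.range n, D.alpha K M t ω s a) atTop atTop)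
    (hα_sq : ∀ᵐ ω ∂μ, ∀ s a, Summable (fun t : ℕ => D.alpha K M t ω s a ^ 2)) :
    ∀ᵐ ω ∂μ, ∀ s a,
      Tendsto (fun t : ℕ => D.Q K M γ Q₀ t ω s a) atTop (𝓝 (𝓜.optimalQ γ s a)) := by
  have hR := ae_all_iff.2 fun s => ae_all_iff.2 fun a => hD.tendsto_condMean hI hK s a
    𝓜.measurable_clampedReward 𝓜.abs_clampedReward_le
  have hP := ae_all_iff.2 fun s => ae_all_iff.2 fun a => ae_all_iff.2 fun x =>
    hD.tendsto_condMean hI hK s a (measurable_nextState x) (abs_nextState_le x)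
  have hnoise := ae_all_iff.2 fun B => ae_all_iff.2 fun s => ae_all_iff.2 fun a =>
    hD.ae_exists_tendsto_sum_noise hI γ Q₀ B s a
  filter_upwards [hvisit, hα_nonneg, hα_sum, hα_sq, hD.ae_abs_reward_le hK, hR, hP, hnoise]
    with ω hv h0 hsum hsq hr h1 h2 h3
  simp only [MDP.integral_clampedReward] at h1
  simp only [MDP.integral_nextState] at h2
  exact D.tendsto_Q 𝓜 hγ0 hγ1 Q₀ hr h0 hsum hsq (fun s a => h1 s a (hv s a))
    (fun s a x => h2 s a x (hv s a)) fun B s a => h3 B s a (hsq s a)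

end ReplayProcess

theorem mainTheorem4
    {S A Ω : Type*}
    [Fintype S] [DecidableEq S] [MeasurableSpace S] [MeasurableSingletonClass S]
    [Fintype A] [DecidableEq A] [MeasurableSpace A] [MeasurableSingletonClass A]
    {mΩ : MeasurableSpace Ω} (μ : Measure Ω) [IsProbabilityMeasure μ]
    (𝓜 : MDP S A) (γ : ℝ) (hγ0 : 0 < γ) (hγ1 : γ < 1)
    (K M : ℕ) (hK : 0 < K) (Q₀ : S → A → ℝ)
    (ℱ : Filtration ℕ mΩ) (D : ReplayProcess Ω S A) (hD : D.IsRun 𝓜 K M μ ℱ)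
    (hvisit : ∀ᵐ ω ∂μ, ∀ s a, {i : ℕ | D.state i ω = s ∧ D.action i ω = a}.Infinite)
    (hα_nonneg : ∀ᵐ ω ∂μ, ∀ s a t, 0 ≤ D.alpha K M t ω s a)
    (hα_sum : ∀ᵐ ω ∂μ, ∀ s a,
      Tendsto (fun n : ℕ => ∑ t ∈ Finset.range n, D.alpha K M t ω s a) atTop atTop)
    (hα_sq : ∀ᵐ ω ∂μ, ∀ s a, Summable (fun t : ℕ => D.alpha K M t ω s a ^ 2)) :
    ∀ᵐ ω ∂μ, ∀ s a,
      Tendsto (fun t : ℕ => D.Q K M γ Q₀ t ω s a) atTop (𝓝 (𝓜.optimalQ γ s a)) := by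
  -- Convergence is proved for the modified process and transferred back on the almost sure event
  -- where all entries, hence all rates and tables, agree.
  filter_upwards [(hD.withIndexInBuffer hK).ae_tendsto_Q
    (D.indexInBuffer_withIndexInBuffer M hK) hK hγ0 hγ1 Q₀ hvisit
    (by
      filter_upwards [hD.ae_entry_eq hK, hα_nonneg] with ω h1 h2 s a t
      rw [ReplayProcess.alpha_withIndexInBuffer h1]
      exact h2 s a t)
    (by
      filter_upwards [hD.ae_entry_eq hK, hα_sum] with ω h1 h2 s a
      simp only [ReplayProcess.alpha_withIndexInBuffer h1]
      exact h2 s a)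
    (by
      filter_upwards [hD.ae_entry_eq hK, hα_sq] with ω h1 h2 s a
      simp only [ReplayProcess.alpha_withIndexInBuffer h1]
      exact h2 s a), hD.ae_entry_eq hK] with ω h1 h2 s a
  simpa only [ReplayProcess.Q_withIndexInBuffer h2] using h1 s a
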